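/- For $n\ge 0$ let $B_n^{\pm}=\{x_1,\dots,x_n,x_1^{-1},\dots,x_n^{-1}\}$, and let $StN_n$ be the group with one generator $\langle\!\langle x,y\rangle\!\rangle$ for all $x,y\in B_n^{\pm}$ with $x\neq y^{\pm1}$, and with the relations (for all letters for which the generators that occur are defined, and with $[a,b]=aba^{-1}b^{-1}$) * (R0) $\langle\!\langle x,y^{-1}\rangle\!\rangle=\langle\!\langle x,y\rangle\!\rangle^{-1}$; * (R1) $[\langle\!\langle x,y\rangle\!\rangle,\langle\!\langle x',y'\rangle\!\rangle]=1$ if $x'\ne y^{\pm1}$, $x'\neq x$ and $x\neq (y')^{\pm1}$; * (R2) $[\langle\!\langle x,y\rangle\!\rangle,\langle\!\langle y,z\rangle\!\rangle]=\langle\!\langle x,z\rangle\!\rangle$ if $x\neq z^{\pm1}$; * (R3) $\langle\!\langle y,x\rangle\!\rangle\langle\!\langle x^{-1},y\rangle\!\rangle\langle\!\langle y^{-1},x^{-1}\rangle\!\rangle=\langle\!\langle y^{-1},x^{-1}\rangle\!\rangle\langle\!\langle x,y^{-1}\rangle\!\rangle\langle\!\langle y,x\rangle\!\rangle$. For a partial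 order $\sigma$ of $\{1,\dots,n\}$ let $T_n^\sigma\subseteq StN_n$ be the triangular subgroup, generated by the elements $\langle\!\langle x_i,x_j\rangle\!\rangle$ and $\langle\!\langle x_i^{-1},x_j\rangle\!\rangle$ with $i>j$ in the order $\sigma$, together with the elements $\langle\!\langle x_i^{-1},x_j\rangle\!\rangle\langle\!\langle x_i,x_j\rangle\!\rangle$ for all $i\neq j$. Let $StN=\varinjlim_n StN_n$. Let $\widetilde X^{\rm alg}=V_{op}(StN,\{T^\sigma\})$ be the geometric realization (with the weak topology) of the simplicial complex whose simplices are the nonempty finite subsets $s\subseteq StN$ such that, for some $n$ and some partial order $\sigma$ of $\{1,\dots,n\}$, all products $a^{-1}b$ with $a,b\in s$ lie in the image of $T_n^\sigma$ in $StN$. The group $StN$ acts on $\widetilde X^{\rm alg}$ simplicially, by left multiplication on vertices. **Proposition.** The group $StN$ acts trivially on both the homology and the homotopy groups of $\widetilde X^{\rm alg}$. That is: 1. for every $k\ge0$ and $g\in StN$, the map $g_*$ on the singular homology group $H_k(\widetilde X^{\rm alg};\mathbb Z)$ is the identity; 2. $\widetilde X^{\rm alg}$ is path connected, and for every $k\geq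 0$, $g\in StN$, every base point $x$ and every path $\gamma$ from $x$ to $gx$, the map $g_*\colon\pi_k(\widetilde X^{\rm alg},x)\to\pi_k(\widetilde X^{\rm alg},gx)$ induced by $g$ is equal to the change-of-basepoint map along $\gamma$. -/

import Mathlib

open scoped unitInterval Topology Topology.Homotopy
open CategoryTheory

noncomputable section

/-! ## The nonabelian Steinberg groups -/

namespace StNGroup

/-- The letters `x₁, …, xₙ, x₁⁻¹, …, xₙ⁻¹`: the pair `(i, true)` stands for `xᵢ` and
`(i, false)` for `xᵢ⁻¹`. -/
abbrev Letter (n : ℕ) : Type := Fin n × Bool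

/-- The formal inverse of a letter. -/
def Letter.inv {n : ℕ} (x : Letter n) : Letter n := (x.1, !x.2)

/-- The letters `x, y` satisfy `x ≠ y` and `x ≠ y⁻¹`. -/
def Indep {n : ℕ} (x y : Letter n) : Prop := x ≠ y ∧ x ≠ y.inv

/-- The generators `⟪x, y⟫`, one for each pair of letters with `x ≠ y^{±1}`. -/
abbrev Gen (n : ℕ) : Type := {p : Letter n × Letter n // Indep p.1 p.2}

/-- The generator `⟪x, y⟫` as an element of the free group on all generators. -/
def gen {n : ℕ} (x y : Letter n) (h : Indep x y) : FreeGroup (Gen n) :=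
  FreeGroup.of ⟨(x, y), h⟩

/-- The commutator `[a, b]`. -/
def comm {n : ℕ} (a b : FreeGroup (Gen n)) : FreeGroup (Gen n) := a * b * a⁻¹ * b⁻¹

/-- The defining relators. -/
inductive Rel (n : ℕ) : FreeGroup (Gen n) → Prop
  | r0 (x y : Letter n) (h : Indep x y) (h' : Indep x y.inv) :
      Rel n (gen x y.inv h' * gen x y h)
  | r1 (x y x' y' : Letter n) (h : Indep x y) (h' : Indep x' y')
      (h₁ : Indep x' y) (h₂ : x' ≠ x) (h₃ : Indep x y') :
      Rel n (comm (gen x y h) (gen x' y' h'))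
  | r2 (x y z : Letter n) (hxy : Indep x y) (hyz : Indep y z) (hxz : Indep x z) :
      Rel n (comm (gen x y hxy) (gen y z hyz) * (gen x z hxz)⁻¹)
  | r3 (x y : Letter n) (h₁ : Indep y x) (h₂ : Indep x.inv y) (h₃ : Indep y.inv x.inv)
      (h₄ : Indep x y.inv) :
      Rel n ((gen y x h₁ * gen x.inv y h₂ * gen y.inv x.inv h₃) *
        (gen y.inv x.inv h₃ * gen x y.inv h₄ * gen y x h₁)⁻¹)

/-- The group `StNₙ`, given by generators and relations. -/
abbrev StNn (n : ℕ) : Type := PresentedGroup {r | Rel n r}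

/-- The class of the generator `⟪x, y⟫` in `StNₙ`. -/
def StNn.gen {n : ℕ} (x y : Letter n) (h : Indep x y) : StNn n :=
  PresentedGroup.of ⟨(x, y), h⟩

/-- The inclusion of the letters of `Fₙ` into those of `Fₘ`, for `n ≤ m`. -/
def Letter.cast {n m : ℕ} (h : n ≤ m) (x : Letter n) : Letter m := (Fin.castLE h x.1, x.2)

theorem Letter.cast_inv {n m : ℕ} (h : n ≤ m) (x : Letter n) :
    x.inv.cast h = (x.cast h).inv := rfl

theorem Letter.cast_injective {n m : ℕ} (h : n ≤ m) :
    Function.Injective (Letter.cast h) := by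
  rintro ⟨i, b⟩ ⟨j, c⟩ hij
  simpa [Letter.cast, Prod.ext_iff] using hij

theorem Indep.cast {n m : ℕ} (h : n ≤ m) {x y : Letter n} (hxy : Indep x y) :
    Indep (x.cast h) (y.cast h) :=
  ⟨fun e => hxy.1 (Letter.cast_injective h e),
    fun e => hxy.2 (Letter.cast_injective h (e.trans (Letter.cast_inv h y).symm))⟩

/-- The inclusion of generators `⟪x, y⟫ ↦ ⟪x, y⟫`, for `n ≤ m`. -/
def Gen.cast {n m : ℕ} (h : n ≤ m) (p : Gen n) : Gen m :=
  ⟨(p.1.1.cast h, p.1.2.cast h), p.2.cast h⟩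

theorem rel_map {n m : ℕ} (h : n ≤ m) :
    Set.MapsTo (FreeGroup.map (Gen.cast h)) {r | Rel n r} {r | Rel m r} := by
  have hg : ∀ (x y : Letter n) (k : Indep x y), FreeGroup.map (Gen.cast h) (StNGroup.gen x y k)
      = StNGroup.gen (x.cast h) (y.cast h) (k.cast h) := fun x y k => by
    simp [StNGroup.gen, Gen.cast]
  rintro r hr
  cases hr with
  | r0 x y k k' =>
    simp only [map_mul, hg, Set.mem_ofPred_eq]
    exact Rel.r0 _ _ _ _
  | r1 x y x' y' k k' k₁ k₂ k₃ =>
    simp only [comm, map_mul, map_inv, hg, Set.mem_ofPred_eq]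
    exact Rel.r1 _ _ _ _ _ _ (k₁.cast h) (fun e => k₂ (Letter.cast_injective h e)) (k₃.cast h)
  | r2 x y z k₁ k₂ k₃ =>
    simp only [comm, map_mul, map_inv, hg, Set.mem_ofPred_eq]
    exact Rel.r2 _ _ _ _ _ _
  | r3 x y k₁ k₂ k₃ k₄ =>
    simp only [map_mul, map_inv, hg, Set.mem_ofPred_eq]
    exact Rel.r3 _ _ _ _ _ _

/-- The stabilization homomorphism `StNₙ → StNₘ`, for `n ≤ m`. -/
def stab (n m : ℕ) (h : n ≤ m) : StNn n →* StNn m :=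
  PresentedGroup.map (FreeGroup.map (Gen.cast h)) (rel_map h)

instance : DirectedSystem StNn (fun n m h => stab n m h) where
  map_self n x := by
    induction x using PresentedGroup.induction_on with
    | H z =>
      change PresentedGroup.mk _ (FreeGroup.map (Gen.cast le_rfl) z) = _
      have : (Gen.cast (le_refl n)) = id := rfl
      rw [this, FreeGroup.map.id]
  map_map n m l hnm hml x := by
    induction x using PresentedGroup.induction_on with
    | H z =>
      change PresentedGroup.mk _ (FreeGroup.map _ (FreeGroup.map _ z)) =
        PresentedGroup.mk _ (FreeGroup.map _ z)
      rw [FreeGroup.map.comp]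
      rfl

/-- The stable group `StN`, the direct limit of the groups `StNₙ`. -/
abbrev StN : Type := DirectLimit StNn stab

/-- The canonical homomorphism `StNₙ → StN`. -/
def toStN (n : ℕ) : StNn n →* StN where
  toFun x := ⟦⟨n, x⟩⟧
  map_one' := (DirectLimit.one_def n).symm
  map_mul' x y := (DirectLimit.mul_def n x y).symm

/-- The triangular subgroup `T_n^s` of `StNₙ` for a partial order `s` of `{1, …, n}`. It is
generated by the `⟪xᵢ, xⱼ⟫` and `⟪xᵢ⁻¹, xⱼ⟫` with `i > j` for `s`, and by the
`⟪xᵢ⁻¹, xⱼ⟫ ⟪xᵢ, xⱼ⟫` with `i ≠ j` arbitrary. -/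
def triangular {n : ℕ} (s : PartialOrder (Fin n)) : Subgroup (StNn n) :=
  Subgroup.closure
    ({g | ∃ (i j : Fin n) (b : Bool) (h : Indep (i, b) (j, true)),
        s.lt j i ∧ g = StNn.gen (i, b) (j, true) h} ∪
      {g | ∃ (i j : Fin n) (h : Indep (i, false) (j, true)) (h' : Indep (i, true) (j, true)),
        g = StNn.gen (i, false) (j, true) h * StNn.gen (i, true) (j, true) h'})

/-- The triangular subgroups of the stable group: the images in `StN` of all `T_n^s`. -/
def stableTriangular (p : Σ n : ℕ, PartialOrder (Fin n)) : Subgroup StN :=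
  (triangular p.2).map (toStN p.1)

end StNGroup

/-! ## The simplicial complex `V_op(G, {Gᵢ})` and its geometric realization -/

/-- The simplicial complex whose simplices are the nonempty finite subsets `s` of `G` such that
all products `a⁻¹ b` with `a, b ∈ s` lie in one of the subgroups `S i`. -/
def Vop (G : Type) [Group G] {ι : Type} (S : ι → Subgroup G) : PreAbstractSimplicialComplex G where
  faces := {s | s.Nonempty ∧ ∃ i, ∀ a ∈ s, ∀ b ∈ s, a⁻¹ * b ∈ S i}
  isRelLowerSet_faces := by
    rintro s ⟨hs, i, hi⟩
    exact ⟨hs, fun t hts ht => ⟨ht, i, fun a ha b hb => hi a (hts ha) b (hts hb)⟩⟩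

/-- The points of the geometric realization of a simplicial complex, in barycentric coordinates:
finitely supported families of nonnegative weights with sum `1` whose support is a simplex. -/
@[ext]
structure Realization {V : Type} (K : PreAbstractSimplicialComplex V) where
  weight : V →₀ ℝ
  nonneg : ∀ v, 0 ≤ weight v
  sum_eq_one : ∑ v ∈ weight.support, weight v = 1
  support_mem : weight.support ∈ K.faces

namespace Realization

variable {V : Type} {K : PreAbstractSimplicialComplex V}

/-- The closed simplex with vertex set `s`, as a map from the standard simplex. -/
def simplexMap (s : K.faces) (w : stdSimplex ℝ (s : Finset V)) : Realization K :=
  have hsum : ∑ v ∈ ((Finsupp.equivFunOnFinite.symm w.1).embDomain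
      (Function.Embedding.subtype (· ∈ (s : Finset V)))).support,
      (Finsupp.equivFunOnFinite.symm w.1).embDomain
        (Function.Embedding.subtype (· ∈ (s : Finset V))) v = 1 := by
    rw [Finsupp.support_embDomain, Finset.sum_map]
    simp only [Finsupp.embDomain_apply_self]
    rw [← w.2.2]
    refine Finset.sum_subset (Finset.subset_univ _) ?_
    intro v _ hv
    simpa using hv
  { weight := (Finsupp.equivFunOnFinite.symm w.1).embDomain
      (Function.Embedding.subtype (· ∈ (s : Finset V)))
    nonneg := by
      intro v
      by_cases hv : v ∈ (s : Finset V)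
      · have := Finsupp.embDomain_apply_self
          (Function.Embedding.subtype (· ∈ (s : Finset V))) (Finsupp.equivFunOnFinite.symm w.1)
          ⟨v, hv⟩
        simp only [Function.Embedding.subtype_apply] at this
        rw [this]
        exact w.2.1 _
      · rw [Finsupp.embDomain_of_notMem_range]
        rintro ⟨a, rfl⟩
        exact hv a.2
    sum_eq_one := hsum
    support_mem := by
      refine (K.isRelLowerSet_faces s.2).2 ?_ ?_
      · rw [Finsupp.support_embDomain]
        intro v hv
        obtain ⟨a, -, rfl⟩ := Finset.mem_map.1 hv
        exact a.2
      · by_contra hne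
        rw [Finset.not_nonempty_iff_eq_empty.1 hne] at hsum
        simp at hsum }

/-- The weak topology: a set is open if and only if its preimage in every closed simplex is. -/
instance : TopologicalSpace (Realization K) :=
  ⨆ s : K.faces, TopologicalSpace.coinduced (simplexMap s) inferInstance

theorem continuous_simplexMap (s : K.faces) : Continuous (simplexMap s) :=
  continuous_iff_coinduced_le.2
    (le_iSup (fun s : K.faces => TopologicalSpace.coinduced (simplexMap s) inferInstance) s)

theorem simplexMap_weight (s : K.faces) (w : stdSimplex ℝ (s : Finset V)) (v : V)
    (hv : v ∈ (s : Finset V)) : (simplexMap s w).weight v = w.1 ⟨v, hv⟩ :=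
  Finsupp.embDomain_apply_self (Function.Embedding.subtype (· ∈ (s : Finset V)))
    (Finsupp.equivFunOnFinite.symm w.1) ⟨v, hv⟩

theorem simplexMap_weight_of_notMem (s : K.faces) (w : stdSimplex ℝ (s : Finset V)) (v : V)
    (hv : v ∉ (s : Finset V)) : (simplexMap s w).weight v = 0 := by
  refine Finsupp.embDomain_of_notMem_range _ _ _ ?_
  rintro ⟨a, rfl⟩
  exact hv a.2

end Realization

namespace Vop

variable {G : Type} [Group G] {ι : Type} {S : ι → Subgroup G}

theorem translate_mem (g : G) {s : Finset G} (hs : s ∈ (Vop G S).faces) :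
    s.map (Equiv.mulLeft g).toEmbedding ∈ (Vop G S).faces := by
  obtain ⟨hne, i, hi⟩ := hs
  refine ⟨hne.map, i, ?_⟩
  intro a ha b hb
  obtain ⟨a, ha', rfl⟩ := Finset.mem_map.1 ha
  obtain ⟨b, hb', rfl⟩ := Finset.mem_map.1 hb
  simpa [mul_assoc] using hi a ha' b hb'

/-- The simplicial action of `G` by left multiplication, `g • ∑ tᵥ v = ∑ tᵥ (g v)`. -/
instance : SMul G (Realization (Vop G S)) where
  smul g p :=
    { weight := p.weight.equivMapDomain (Equiv.mulLeft g)
      nonneg := fun v => p.nonneg _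
      sum_eq_one := by
        rw [← p.sum_eq_one]
        change ∑ v ∈ p.weight.support.map (Equiv.mulLeft g).toEmbedding, _ = _
        rw [Finset.sum_map]
        simp
      support_mem := translate_mem g p.support_mem }

theorem smul_weight (g : G) (p : Realization (Vop G S)) (v : G) :
    (g • p).weight v = p.weight (g⁻¹ * v) := rfl

instance : MulAction G (Realization (Vop G S)) where
  one_smul p := by
    ext v
    simp [smul_weight]
  mul_smul g h p := by
    ext v
    simp [smul_weight, mul_assoc]

instance : ContinuousConstSMul G (Realization (Vop G S)) where
  continuous_const_smul g := by
    refine continuous_iSup_dom.2 fun s => continuous_coinduced_dom.2 ?_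
    let s' : (Vop G S).faces := ⟨_, translate_mem g s.2⟩
    have hmem : ∀ v : (s' : Finset G), g⁻¹ * v.1 ∈ (s : Finset G) := by
      rintro ⟨v, hv⟩
      obtain ⟨a, ha, rfl⟩ := Finset.mem_map.1 hv
      simpa using ha
    let φ : stdSimplex ℝ (s : Finset G) → stdSimplex ℝ (s' : Finset G) := fun w =>
      ⟨fun v => w.1 ⟨g⁻¹ * v.1, hmem v⟩, fun v => w.2.1 _, by
        rw [← w.2.2]
        refine Fintype.sum_bijective (fun v : (s' : Finset G) =>
          (⟨g⁻¹ * v.1, hmem v⟩ : (s : Finset G))) ⟨?_, ?_⟩ _ _ fun v => rfl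
        · intro a b hab
          exact Subtype.ext (mul_left_cancel (congrArg Subtype.val hab))
        · rintro ⟨a, ha⟩
          exact ⟨⟨g * a, Finset.mem_map.2 ⟨a, ha, rfl⟩⟩, Subtype.ext (inv_mul_cancel_left g a)⟩⟩
    have hφ : Continuous φ := by
      refine Continuous.subtype_mk ?_ _
      exact continuous_pi fun v => (continuous_apply _).comp continuous_subtype_val
    have key : ((fun p : Realization (Vop G S) => g • p) ∘ Realization.simplexMap s) =
        Realization.simplexMap s' ∘ φ := by
      funext w
      ext v
      simp only [Function.comp_apply, smul_weight]
      by_cases hv : v ∈ (s' : Finset G)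
      · rw [Realization.simplexMap_weight s' _ v hv,
          Realization.simplexMap_weight s _ _ (hmem ⟨v, hv⟩)]
      · rw [Realization.simplexMap_weight_of_notMem s' _ v hv,
          Realization.simplexMap_weight_of_notMem]
        intro h
        exact hv (Finset.mem_map.2 ⟨_, h, mul_inv_cancel_left g v⟩)
    rw [key]
    exact (Realization.continuous_simplexMap s').comp hφ

/-- Left translation by `g`, as a continuous self-map of the realization of `V_op(G, {Gᵢ})`. -/
def translation (g : G) : C(Realization (Vop G S), Realization (Vop G S)) :=
  ⟨fun p => g • p, continuous_const_smul g⟩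

end Vop

/-- The stable space `X̃^alg = V_op(StN, {T^σ})`. -/
abbrev XAlg : Type := Realization (Vop StNGroup.StN StNGroup.stableTriangular)

/-! ## Induced maps and change of basepoint on homotopy groups -/

namespace HomotopyGroup

variable {X Y : Type} [TopologicalSpace X] [TopologicalSpace Y]

/-- The map `π_k(X, x) → π_k(Y, f x)` induced by a continuous map `f`. -/
def induced (k : ℕ) (f : C(X, Y)) (x : X) : π_ k X x → π_ k Y (f x) :=
  Quotient.map (sa := GenLoop.Homotopic.setoid (Fin k) x)
    (sb := GenLoop.Homotopic.setoid (Fin k) (f x))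
    (fun p => ⟨f.comp p.1, fun t ht => congrArg f (p.2 t ht)⟩)
    fun _ _ h => ContinuousMap.HomotopicRel.comp_continuousMap h f

/-- The distance from the centre of the cube `I^k`, normalized to be `1` on the boundary. -/
def cubeRadius {k : ℕ} (t : I^ (Fin k)) : ℝ := ‖fun i => 2 * (t i : ℝ) - 1‖

/-- The expansion by the factor `2` of the concentric subcube of half the size to `I^k`. -/
def cubeExpand {k : ℕ} (t : I^ (Fin k)) : I^ (Fin k) :=
  fun i => Set.projIcc 0 1 zero_le_one (2 * (t i : ℝ) - 1 / 2)

theorem continuous_cubeRadius {k : ℕ} : Continuous (cubeRadius (k := k)) := by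
  unfold cubeRadius
  fun_prop

theorem continuous_cubeExpand {k : ℕ} : Continuous (cubeExpand (k := k)) := by
  unfold cubeExpand
  refine continuous_pi fun i => continuous_projIcc.comp ?_
  fun_prop

theorem cubeRadius_of_mem_boundary {k : ℕ} {t : I^ (Fin k)} (ht : t ∈ Cube.boundary (Fin k)) :
    cubeRadius t = 1 := by
  refine le_antisymm ?_ ?_
  · refine (pi_norm_le_iff_of_nonneg zero_le_one).2 fun i => ?_
    rw [Real.norm_eq_abs, abs_le]
    constructor <;> linarith [(t i).2.1, (t i).2.2]
  · obtain ⟨i, hi⟩ := ht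
    refine le_trans ?_ (norm_le_pi_norm (fun i => 2 * (t i : ℝ) - 1) i)
    rcases hi with hi | hi <;> rw [hi] <;> norm_num

theorem cubeExpand_mem_boundary {k : ℕ} {t : I^ (Fin k)} (ht : cubeRadius t = 1 / 2) :
    cubeExpand t ∈ Cube.boundary (Fin k) := by
  by_contra hcon
  have hlt : ∀ i, ‖2 * (t i : ℝ) - 1‖ < 1 / 2 := by
    intro i
    rw [Real.norm_eq_abs, abs_lt]
    constructor
    · by_contra h
      exact hcon ⟨i, Or.inl (Set.projIcc_of_le_left _ (by linarith))⟩
    · by_contra h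
      exact hcon ⟨i, Or.inr (Set.projIcc_of_right_le _ (by linarith))⟩
  have := (pi_norm_lt_iff (by norm_num : (0 : ℝ) < 1 / 2)).2 hlt
  exact absurd ht (ne_of_lt this)

/-- Transport of a generalized loop along a path `γ` from `x` to `y`: the loop is shrunk to the
concentric subcube of half the size, and `γ` is put on every radial segment of the remaining
shell. -/
def transportLoop {k : ℕ} {x y : X} (γ : Path x y) (p : Ω^ (Fin k) X x) : Ω^ (Fin k) X y :=
  ⟨⟨fun t => if cubeRadius t ≤ 1 / 2 then p (cubeExpand t) else γ.extend (2 * cubeRadius t - 1), by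
      refine Continuous.if_le ?_ ?_ continuous_cubeRadius continuous_const ?_
      · exact p.1.continuous.comp continuous_cubeExpand
      · exact γ.continuous_extend.comp ((continuous_const.mul continuous_cubeRadius).sub
          continuous_const)
      · intro t ht
        rw [show p (cubeExpand t) = x from p.2 _ (cubeExpand_mem_boundary ht), ht]
        norm_num⟩, by
    intro t ht
    have h := cubeRadius_of_mem_boundary ht
    simp only [ContinuousMap.coe_mk, h]
    norm_num⟩

theorem transportLoop_homotopic {k : ℕ} {x y : X} (γ : Path x y) {p q : Ω^ (Fin k) X x}
    (h : GenLoop.Homotopic p q) :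
    GenLoop.Homotopic (transportLoop γ p) (transportLoop γ q) := by
  obtain ⟨H⟩ := h
  refine ⟨⟨⟨⟨fun u => if cubeRadius u.2 ≤ 1 / 2 then H (u.1, cubeExpand u.2)
    else γ.extend (2 * cubeRadius u.2 - 1), ?_⟩, ?_, ?_⟩, ?_⟩⟩
  · refine Continuous.if_le ?_ ?_ (continuous_cubeRadius.comp continuous_snd) continuous_const ?_
    · exact H.continuous.comp (continuous_fst.prodMk (continuous_cubeExpand.comp continuous_snd))
    · exact γ.continuous_extend.comp ((continuous_const.mul
        (continuous_cubeRadius.comp continuous_snd)).sub continuous_const)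
    · rintro ⟨s, t⟩ ht
      have hb := cubeExpand_mem_boundary ht
      have h1 : H (s, cubeExpand t) = x := (H.eq_fst s hb).trans (p.2 _ hb)
      rw [h1, ht]
      norm_num
  · intro t
    simp [transportLoop]
  · intro t
    simp [transportLoop]
  · intro s t ht
    have h := cubeRadius_of_mem_boundary ht
    simp only [ContinuousMap.coe_mk, transportLoop, h]
    norm_num

/-- The change-of-basepoint map `π_k(X, x) → π_k(X, y)` along a path from `x` to `y`. -/
def transport {k : ℕ} {x y : X} (γ : Path x y) : π_ k X x → π_ k X y :=
  Quotient.map (sa := GenLoop.Homotopic.setoid (Fin k) x)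
    (sb := GenLoop.Homotopic.setoid (Fin k) y) (transportLoop γ)
    fun _ _ h => transportLoop_homotopic γ h

end HomotopyGroup

/-- The `k`-th singular homology group of a space with integer coefficients. -/
abbrev integralHomology (k : ℕ) : TopCat.{0} ⥤ ModuleCat.{0} ℤ :=
  (AlgebraicTopology.singularHomologyFunctor (ModuleCat.{0} ℤ) k).obj (ModuleCat.of ℤ ℤ)

end

noncomputable section

/-! ## The topology of the realization -/

namespace Realization

variable {V : Type} {K : PreAbstractSimplicialComplex V}

/-! The heart is `translation_comp_homotopic`: for a map `f` from a compact space to the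
realization, every translate `g • f` is homotopic to `f`. A compact set meets only finitely many
open stars, so the image of `f`, with all simplices involved, lives at some stage `N`. The index
added in passing from `N` to `N + 1` gives two subgroups, the lower one (⟪x, z⟫ and the conjugations
of the new letter `z`) and the upper one (⟪z^{±1}, y⟫). Both are normalized by the image of stage
`N` (`el_mem_normalizer_lowerSubgroup`, `el_mem_normalizer_upperSubgroup`), and each lies with any
given earlier triangular subgroup in one triangular subgroup, since the new index may be declared
smallest or largest. If `u` is in one of them and `a` is a vertex of a simplex involved, then `u a =
a (a⁻¹ u a)`, so `u • p` and `p` lie in a common simplex (`contiguous_smul`) and the straight-line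
homotopy joins `u • f` to `f`. The elements that move `f` within its homotopy class form a subgroup,
and by (R2) every generator at stage `N` is a commutator of a lower and an upper element. As the
same works at all later stages, the subgroup is everything.

Homology follows because every singular cycle has compact support. For homotopy groups, the free
homotopy from a loop to its translate identifies the induced map with transport along the track of
the base point; that any other path serves equally well is simple connectivity.

Simple connectivity holds because `StN` is the amalgam of its triangular subgroups: every defining
relation is a consequence of relations inside single triangular subgroups. For (R3) this needs a
rewriting (`braid_iff`, `conjEl_mul_conjEl`). For an amalgam, prolonging paths by edges extends to
an action of the group, which selects a consistent class of paths from the base vertex to every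
point. -/

theorem continuous_dom_iff {Y : Type*} [TopologicalSpace Y] {f : Realization K → Y} :
    Continuous f ↔ ∀ s : K.faces, Continuous (f ∘ simplexMap s) := by
  simp only [continuous_iSup_dom, continuous_coinduced_dom]

theorem continuous_weight (v : V) : Continuous fun p : Realization K => p.weight v := by
  refine continuous_dom_iff.2 fun s => ?_
  by_cases hv : v ∈ (s : Finset V)
  · have : (fun p : Realization K => p.weight v) ∘ simplexMap s = fun w => w.1 ⟨v, hv⟩ :=
      funext fun w => simplexMap_weight s w v hv
    rw [this]
    exact (continuous_apply _).comp continuous_subtype_val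
  · have : (fun p : Realization K => p.weight v) ∘ simplexMap s = fun _ => 0 :=
      funext fun w => simplexMap_weight_of_notMem s w v hv
    rw [this]
    exact continuous_const

theorem continuous_coords : Continuous fun (p : Realization K) (v : V) => p.weight v :=
  continuous_pi continuous_weight

theorem injective_coords : Function.Injective fun (p : Realization K) (v : V) => p.weight v :=
  fun _ _ h => Realization.ext (Finsupp.ext fun v => congrFun h v)

instance : T2Space (Realization K) :=
  .of_injective_continuous injective_coords continuous_coords

/-- Linear functions of the barycentric coordinates are continuous, whatever the coefficients. -/
theorem continuous_weightedSum (c : V → ℝ) :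
    Continuous fun p : Realization K => p.weight.sum fun v r => c v * r := by
  refine continuous_dom_iff.2 fun s => ?_
  have : (fun p : Realization K => p.weight.sum fun v r => c v * r) ∘ simplexMap s =
      fun w => ∑ v : (s : Finset V), c v * w.1 v := by
    funext w
    simp only [Function.comp_apply, simplexMap, Finsupp.sum_embDomain]
    rw [Finsupp.sum_fintype _ _ (by simp)]
    rfl
  rw [this]
  exact continuous_finsetSum _ fun v _ =>
    continuous_const.mul ((continuous_apply v).comp continuous_subtype_val)

/-- A compact set meets only finitely many open stars of vertices. -/
theorem exists_finset_of_isCompact {C : Set (Realization K)} (hC : IsCompact C) :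
    ∃ F : Finset V, ∀ p ∈ C, p.weight.support ⊆ F := by
  by_cases hfin : {v | ∃ p ∈ C, v ∈ p.weight.support}.Finite
  · exact ⟨hfin.toFinset, fun p hp v hv => hfin.mem_toFinset.2 ⟨p, hp, hv⟩⟩
  exfalso
  have := Set.infinite_coe_iff.2 hfin
  let v := Infinite.natEmbedding {v | ∃ p ∈ C, v ∈ p.weight.support}
  choose p hpC hp using fun i => (v i).2
  have hpos : ∀ i, 0 < (p i).weight (v i) := fun i =>
    lt_of_le_of_ne ((p i).nonneg _) (Ne.symm (Finsupp.mem_support_iff.1 (hp i)))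
  have hinj : Function.Injective fun i => (v i : V) :=
    Subtype.val_injective.comp v.injective
  -- With these coefficients the linear function is at least `i` at the point `p i`, so it is
  -- unbounded on `C` although continuous.
  let c : V → ℝ := Function.extend (fun i => (v i : V)) (fun i => i / (p i).weight (v i)) 0
  have hc : ∀ i, c (v i) = i / (p i).weight (v i) := fun i => hinj.extend_apply _ _ i
  have hc0 : ∀ u, 0 ≤ c u := by
    intro u
    by_cases hu : ∃ i, (v i : V) = u
    · obtain ⟨i, rfl⟩ := hu
      rw [hc]
      exact div_nonneg (Nat.cast_nonneg _) (hpos i).le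
    · rw [show c u = 0 from Function.extend_apply' _ _ _ hu]
  obtain ⟨M, hM⟩ := (hC.image (continuous_weightedSum c)).bddAbove
  obtain ⟨i, hi⟩ := exists_nat_gt M
  have h1 := hM ⟨p i, hpC i, rfl⟩
  have h2 : (i : ℝ) ≤ (p i).weight.sum fun v r => c v * r := by
    calc (i : ℝ) = c (v i) * (p i).weight (v i) := by
          rw [hc, div_mul_cancel₀ _ (hpos i).ne']
      _ ≤ _ := Finset.single_le_sum (f := fun u => c u * (p i).weight u)
          (fun u _ => mul_nonneg (hc0 u) ((p i).nonneg u)) (hp i)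
  exact absurd (h2.trans h1) (not_le.2 hi)

theorem mem_range_simplexMap (p : Realization K) (s : K.faces)
    (h : p.weight.support ⊆ (s : Finset V)) : p ∈ Set.range (simplexMap s) := by
  refine ⟨⟨fun v => p.weight v, fun v => p.nonneg _, ?_⟩, ?_⟩
  · rw [Finset.sum_coe_sort (s : Finset V) fun v => p.weight v, ← p.sum_eq_one]
    exact (Finset.sum_subset h fun v _ hv => Finsupp.notMem_support_iff.1 hv).symm
  · ext v
    by_cases hv : v ∈ (s : Finset V)
    · rw [simplexMap_weight s _ v hv]
    · rw [simplexMap_weight_of_notMem s _ v hv]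
      exact (Finsupp.notMem_support_iff.1 fun hv' => hv (h hv')).symm

/-- Only finitely many closed simplices have their vertices in `F`, and each is compact. -/
theorem isCompact_setOf_support_subset (F : Finset V) :
    IsCompact {p : Realization K | p.weight.support ⊆ F} := by
  have hfin : {s : K.faces | (s : Finset V) ⊆ F}.Finite :=
    Set.Finite.of_finite_image (f := Subtype.val)
      ((Finset.finite_toSet F.powerset).subset (by
        rintro _ ⟨s, hs, rfl⟩
        exact Finset.mem_coe.2 (Finset.mem_powerset.2 hs))) Subtype.val_injective.injOn
  have : {p : Realization K | p.weight.support ⊆ F} =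
      ⋃ s ∈ {s : K.faces | (s : Finset V) ⊆ F}, Set.range (simplexMap s) := by
    ext p
    simp only [Set.mem_ofPred_eq, Set.mem_iUnion]
    constructor
    · exact fun hp => ⟨⟨_, p.support_mem⟩, hp, mem_range_simplexMap p _ subset_rfl⟩
    · rintro ⟨s, hs, w, rfl⟩ v hv
      by_contra hvF
      exact Finsupp.mem_support_iff.1 hv
        (simplexMap_weight_of_notMem s w v fun h => hvF (hs h))
  rw [this]
  exact hfin.isCompact_biUnion fun s _ => isCompact_range (continuous_simplexMap s)

/-- On a finite full subcomplex, continuity can be checked on barycentric coordinates. -/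
theorem continuous_of_weight {Z : Type*} [TopologicalSpace Z] {f : Z → Realization K}
    (F : Finset V) (hF : ∀ z, (f z).weight.support ⊆ F)
    (hf : ∀ v, Continuous fun z => (f z).weight v) : Continuous f := by
  have := isCompact_iff_compactSpace.1 (isCompact_setOf_support_subset (K := K) F)
  let e : {p : Realization K | p.weight.support ⊆ F} → V → ℝ := fun p v => p.1.weight v
  -- A continuous injection from a compact space to a Hausdorff space: on a finite subcomplex the
  -- weak topology is the one given by the coordinates.
  have he : Topology.IsClosedEmbedding e := Continuous.isClosedEmbedding
    (continuous_coords.comp continuous_subtype_val)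
    (injective_coords.comp Subtype.val_injective)
  have : Continuous fun z => (⟨f z, hF z⟩ : {p : Realization K | p.weight.support ⊆ F}) :=
    he.isEmbedding.continuous_iff.2 (continuous_pi hf)
  exact continuous_subtype_val.comp this

/-! ## Straight-line homotopies -/

/-- Two points lie in a common closed simplex. -/
def Contiguous (p q : Realization K) : Prop :=
  ∃ s ∈ K.faces, p.weight.support ⊆ s ∧ q.weight.support ⊆ s

theorem Contiguous.symm {p q : Realization K} (h : Contiguous p q) : Contiguous q p :=
  let ⟨s, hs, hp, hq⟩ := h
  ⟨s, hs, hq, hp⟩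

/-- The point dividing the segment from `p` to `q` in the ratio `t : 1 - t`. -/
def mix {p q : Realization K} (h : Contiguous p q) (t : I) : Realization K :=
  have hsum : ∑ v ∈ ((1 - t : ℝ) • p.weight + (t : ℝ) • q.weight).support,
      ((1 - t : ℝ) • p.weight + (t : ℝ) • q.weight) v = 1 := by
    have hlin : ∀ w : V →₀ ℝ,
        ∑ v ∈ w.support, w v = Finsupp.linearCombination ℝ (fun _ => (1 : ℝ)) w := by
      intro w
      simp [Finsupp.linearCombination_apply, Finsupp.sum]
    rw [hlin, map_add, map_smul, map_smul, ← hlin, ← hlin, p.sum_eq_one, q.sum_eq_one]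
    simp
  { weight := (1 - t : ℝ) • p.weight + (t : ℝ) • q.weight
    nonneg := fun v => add_nonneg
      (mul_nonneg (sub_nonneg.2 t.2.2) (p.nonneg v)) (mul_nonneg t.2.1 (q.nonneg v))
    sum_eq_one := hsum
    support_mem := by
      obtain ⟨s, hs, hp, hq⟩ := h
      refine (K.isRelLowerSet_faces hs).2 ?_ ?_
      · intro v hv
        by_contra hvs
        refine Finsupp.mem_support_iff.1 hv ?_
        simp [Finsupp.notMem_support_iff.1 fun h => hvs (hp h),
          Finsupp.notMem_support_iff.1 fun h => hvs (hq h)]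
      · by_contra hne
        rw [Finset.not_nonempty_iff_eq_empty.1 hne] at hsum
        simp at hsum }

theorem mix_weight {p q : Realization K} (h : Contiguous p q) (t : I) (v : V) :
    (mix h t).weight v = (1 - t) * p.weight v + t * q.weight v := rfl

theorem mix_zero {p q : Realization K} (h : Contiguous p q) : mix h 0 = p := by
  ext v
  simp [mix_weight]

theorem mix_one {p q : Realization K} (h : Contiguous p q) : mix h 1 = q := by
  ext v
  simp [mix_weight]

theorem mix_self {p : Realization K} (h : Contiguous p p) (t : I) : mix h t = p := by
  ext v
  rw [mix_weight]
  ring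

theorem support_mix_subset {p q : Realization K} (h : Contiguous p q) (t : I) {s : Finset V}
    (hp : p.weight.support ⊆ s) (hq : q.weight.support ⊆ s) :
    (mix h t).weight.support ⊆ s := by
  intro v hv
  by_contra hvs
  refine Finsupp.mem_support_iff.1 hv ?_
  rw [mix_weight, Finsupp.notMem_support_iff.1 fun h => hvs (hp h),
    Finsupp.notMem_support_iff.1 fun h => hvs (hq h)]
  simp

/-- Pointwise contiguous maps on a compact space are homotopic by the straight-line homotopy. -/
def straightHomotopy {Z : Type*} [TopologicalSpace Z] [CompactSpace Z]
    (f₀ f₁ : C(Z, Realization K)) (h : ∀ z, Contiguous (f₀ z) (f₁ z)) :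
    ContinuousMap.HomotopyRel f₀ f₁ {z | f₀ z = f₁ z} where
  toFun u := mix (h u.2) u.1
  continuous_toFun := by
    classical
    -- Compactness confines the whole homotopy to a finite subcomplex; outside one, continuity of
    -- the coordinates would not suffice for the weak topology.
    obtain ⟨F₀, hF₀⟩ := exists_finset_of_isCompact (isCompact_range f₀.continuous)
    obtain ⟨F₁, hF₁⟩ := exists_finset_of_isCompact (isCompact_range f₁.continuous)
    refine continuous_of_weight (F₀ ∪ F₁) (fun u => support_mix_subset _ _
      ((hF₀ _ ⟨_, rfl⟩).trans Finset.subset_union_left)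
      ((hF₁ _ ⟨_, rfl⟩).trans Finset.subset_union_right)) fun v => ?_
    simp only [mix_weight]
    have h₀ := (continuous_weight v).comp f₀.continuous
    have h₁ := (continuous_weight v).comp f₁.continuous
    have ht : Continuous fun u : I × Z => (u.1 : ℝ) := by fun_prop
    exact ((continuous_const.sub ht).mul (h₀.comp continuous_snd)).add
      (ht.mul (h₁.comp continuous_snd))
  map_zero_left z := mix_zero _
  map_one_left z := mix_one _
  prop' t z hz := by
    change mix (h z) t = f₀ z
    have : ∀ q (hq : Contiguous (f₀ z) q), q = f₀ z → mix hq t = f₀ z := by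
      rintro q hq rfl
      exact mix_self hq t
    exact this _ (h z) (Eq.symm hz)

/-- The segment from `p` to `q`, as a path. -/
def line {p q : Realization K} (h : Contiguous p q) : Path p q where
  toFun t := mix h t
  continuous_toFun := by
    obtain ⟨s, -, hp, hq⟩ := id h
    refine continuous_of_weight s (fun t => support_mix_subset h t hp hq) fun v => ?_
    simp only [mix_weight]
    fun_prop
  source' := mix_zero h
  target' := mix_one h

/-- The straight-line homotopy is stationary wherever the two maps agree, in particular at the end
points. -/
theorem homotopic_of_contiguous {p q : Realization K} (γ₀ γ₁ : Path p q)
    (h : ∀ t, Contiguous (γ₀ t) (γ₁ t)) : γ₀.Homotopic γ₁ := by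
  have H := straightHomotopy γ₀.toContinuousMap γ₁.toContinuousMap h
  refine ⟨⟨H.toHomotopy, fun t z hz => H.prop' t z ?_⟩⟩
  rcases hz with rfl | rfl
  · exact γ₀.source.trans γ₁.source.symm
  · exact γ₀.target.trans γ₁.target.symm

/-- The two ways along the boundary of a triangle in a simplex are homotopic. -/
theorem line_trans_line {p q r : Realization K} {s : Finset V} (hs : s ∈ K.faces)
    (hp : p.weight.support ⊆ s) (hq : q.weight.support ⊆ s) (hr : r.weight.support ⊆ s)
    (hpq : Contiguous p q) (hqr : Contiguous q r) (hpr : Contiguous p r) :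
    (Path.Homotopic.Quotient.mk (line hpq)).trans (.mk (line hqr)) = .mk (line hpr) := by
  rw [← Path.Homotopic.Quotient.mk_trans]
  refine Path.Homotopic.Quotient.eq.2 (homotopic_of_contiguous _ _ fun t => ?_)
  refine ⟨s, hs, ?_, support_mix_subset hpr t hp hr⟩
  rw [Path.trans_apply]
  split_ifs
  · exact support_mix_subset hpq _ hp hq
  · exact support_mix_subset hqr _ hq hr

theorem line_self {p : Realization K} (h : Contiguous p p) : line h = Path.refl p :=
  Path.ext (funext fun t => mix_self h t)

/-! ### Vertices and their open stars -/

/-- The point of the realization given by a vertex. -/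
def vertex (v : V) (hv : {v} ∈ K.faces) : Realization K where
  weight := Finsupp.single v 1
  nonneg u := by
    classical
    rw [Finsupp.single_apply]
    split_ifs <;> norm_num
  sum_eq_one := by
    rw [Finsupp.support_single _ one_ne_zero]
    simp
  support_mem := by rwa [Finsupp.support_single _ one_ne_zero]

theorem support_vertex (v : V) (hv : {v} ∈ K.faces) : (vertex v hv).weight.support = {v} :=
  Finsupp.support_single _ one_ne_zero

/-- The open star of a vertex. -/
def star (K : PreAbstractSimplicialComplex V) (v : V) : Set (Realization K) :=
  {p | v ∈ p.weight.support}

theorem isOpen_star (v : V) : IsOpen (star K v) := by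
  have : star K v = (fun p : Realization K => p.weight v) ⁻¹' {0}ᶜ := by
    ext p
    simp [star]
  rw [this]
  exact isOpen_compl_singleton.preimage (continuous_weight v)

theorem iUnion_star : ⋃ v, star K v = Set.univ :=
  Set.eq_univ_of_forall fun p => Set.mem_iUnion.2 (K.isRelLowerSet_faces p.support_mem).1

theorem contiguous_vertex {p : Realization K} {v : V} (hv : {v} ∈ K.faces) (hp : p ∈ star K v) :
    Contiguous (vertex v hv) p :=
  ⟨_, p.support_mem, by rw [support_vertex]; exact Finset.singleton_subset_iff.2 hp, subset_rfl⟩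

/-- A path in an open star is homotopic to the path through the vertex. -/
theorem line_trans_of_mem_star {p q : Realization K} {v : V} (hv : {v} ∈ K.faces) (δ : Path p q)
    (hδ : ∀ t, δ t ∈ star K v) (hp : Contiguous (vertex v hv) p) (hq : Contiguous (vertex v hv) q) :
    (Path.Homotopic.Quotient.mk (line hp)).trans (.mk δ) = .mk (line hq) := by
  rw [← Path.Homotopic.Quotient.mk_trans]
  refine Path.Homotopic.Quotient.eq.2 ?_
  obtain ⟨f, rfl, rfl⟩ := δ
  -- The naturality square of the straight-line homotopy from the constant map at the vertex to `f`:
  -- one side is constant, the opposite side is `f`, and the other two are the segments to its end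
  -- points.
  have key := Path.Homotopic.map_trans_evalAt
    (straightHomotopy (ContinuousMap.const I (vertex v hv)) f
      fun t => contiguous_vertex hv (hδ t)).toHomotopy unitInterval.path01
  refine Path.Homotopic.symm (Path.Homotopic.trans ?_ key)
  exact ⟨(Path.Homotopy.reflTrans (line hq)).symm⟩

end Realization

/-! ## Calculations in the nonabelian Steinberg groups -/

namespace StNGroup

theorem indep_iff {n : ℕ} {x y : Letter n} : Indep x y ↔ x.1 ≠ y.1 := by
  obtain ⟨i, b⟩ := x
  obtain ⟨j, c⟩ := y
  simp only [Indep, Letter.inv, ne_eq, Prod.mk.injEq]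
  cases b <;> cases c <;> simp

theorem Letter.inv_inv {n : ℕ} (x : Letter n) : x.inv.inv = x := by
  simp [Letter.inv]

theorem Letter.ne_inv {n : ℕ} (x : Letter n) : x ≠ x.inv := by
  simp [Letter.inv, Prod.ext_iff]

theorem Letter.eq_or_eq_inv {n : ℕ} {x y : Letter n} (h : x.1 = y.1) : x = y ∨ x = y.inv := by
  by_contra! hne
  exact indep_iff.1 hne h

open scoped Classical in
/-- The generator `⟪x, y⟫`, extended by `1` to all pairs of letters. -/
def StNn.el {n : ℕ} (x y : Letter n) : StNn n :=
  if h : Indep x y then StNn.gen x y h else 1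

open StNn

variable {n : ℕ}

theorem el_of_indep {x y : Letter n} (h : Indep x y) : el x y = StNn.gen x y h := dif_pos h

theorem el_of_eq {x y : Letter n} (h : x.1 = y.1) : el x y = 1 :=
  dif_neg fun h' => indep_iff.1 h' h

theorem mk_gen (x y : Letter n) (h : Indep x y) :
    PresentedGroup.mk {r | Rel n r} (StNGroup.gen x y h) = el x y :=
  (el_of_indep h).symm

theorem el_inv_right (x y : Letter n) : el x y.inv = (el x y)⁻¹ := by
  by_cases h : x.1 = y.1
  · rw [el_of_eq h, el_of_eq (x := x) (y := y.inv) h, inv_one]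
  · have := PresentedGroup.one_of_mem (rels := {r | Rel n r})
      (Rel.r0 x y (indep_iff.2 h) (indep_iff.2 h))
    rw [map_mul, mk_gen, mk_gen] at this
    exact eq_inv_of_mul_eq_one_left this

theorem el_commute {x y x' y' : Letter n} (h₁ : x'.1 ≠ y.1) (h₂ : x' ≠ x) (h₃ : x.1 ≠ y'.1) :
    Commute (el x y) (el x' y') := by
  by_cases h : x.1 = y.1
  · rw [el_of_eq h]
    exact Commute.one_left _
  by_cases h' : x'.1 = y'.1
  · rw [el_of_eq h']
    exact Commute.one_right _
  have := PresentedGroup.one_of_mem (rels := {r | Rel n r})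
    (Rel.r1 x y x' y' (indep_iff.2 h) (indep_iff.2 h') (indep_iff.2 h₁) h₂ (indep_iff.2 h₃))
  rw [comm] at this
  simp only [map_mul, map_inv, mk_gen] at this
  exact mul_inv_eq_iff_eq_mul.1 (mul_inv_eq_one.1 this)

theorem el_mul_el {x y z : Letter n} (hxy : x.1 ≠ y.1) (hyz : y.1 ≠ z.1) (hxz : x.1 ≠ z.1) :
    el x y * el y z = el x z * el y z * el x y := by
  have := PresentedGroup.one_of_mem (rels := {r | Rel n r})
    (Rel.r2 x y z (indep_iff.2 hxy) (indep_iff.2 hyz) (indep_iff.2 hxz))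
  rw [comm] at this
  simp only [map_mul, map_inv, mk_gen] at this
  exact mul_inv_eq_iff_eq_mul.1 (mul_inv_eq_iff_eq_mul.1 (mul_inv_eq_one.1 this))

theorem el_commutator {x y z : Letter n} (hxy : x.1 ≠ y.1) (hyz : y.1 ≠ z.1) (hxz : x.1 ≠ z.1) :
    el x z = el x y * el y z * (el x y)⁻¹ * (el y z)⁻¹ := by
  rw [el_mul_el hxy hyz hxz]
  group

theorem el_braid {x y : Letter n} (h : x.1 ≠ y.1) :
    el y x * el x.inv y * el y.inv x.inv = el y.inv x.inv * el x y.inv * el y x := by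
  have := PresentedGroup.one_of_mem (rels := {r | Rel n r})
    (Rel.r3 x y (indep_iff.2 h.symm) (indep_iff.2 h) (indep_iff.2 h.symm) (indep_iff.2 h))
  simp only [map_mul, map_inv, mk_gen] at this
  exact mul_inv_eq_one.1 this

/-- The element `⟪x⁻¹, y⟫ ⟪x, y⟫`, which stands for the conjugation of `x` by `y`. -/
def StNn.conjEl (x y : Letter n) : StNn n := el x.inv y * el x y

/-- (R1) excludes `x' = x` but allows `x' = x⁻¹`. -/
theorem el_inv_commute (x y : Letter n) : Commute (el x.inv y) (el x y) := by
  by_cases h : x.1 = y.1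
  · rw [el_of_eq h]
    exact Commute.one_right _
  · exact el_commute h x.ne_inv h

theorem conjEl_inv_left (x y : Letter n) : conjEl x.inv y = conjEl x y := by
  rw [conjEl, conjEl, Letter.inv_inv]
  exact (el_inv_commute x y).symm

theorem conjEl_inv_right (x y : Letter n) : conjEl x y.inv = (conjEl x y)⁻¹ := by
  rw [conjEl, conjEl, el_inv_right, el_inv_right, mul_inv_rev]
  exact (el_inv_commute x y).inv_inv

theorem el_commute_conjEl (x y : Letter n) : Commute (el x y) (conjEl x y) :=
  (el_inv_commute x y).symm.mul_right (Commute.refl _)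

/-- In the presence of the other relations, (R3) is a relation in a single triangular group. -/
theorem braid_iff {G : Type*} [Group G] {A B c c' : G} (h : Commute B c') :
    B * (c * A) * (B * c'⁻¹) = B * c'⁻¹ * A * B ↔ c' * c * A = A * c' := by
  -- Both sides of (R3) are the sides of the shorter relation, multiplied by `B c'⁻¹` on the left
  -- and by `c'⁻¹ B` on the right.
  have e1 : B * (c * A) * (B * c'⁻¹) = B * c'⁻¹ * (c' * c * A) * (c'⁻¹ * B) := by
    rw [show B * c'⁻¹ * (c' * c * A) * (c'⁻¹ * B) = B * (c * A) * (c'⁻¹ * B) by group,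
      h.inv_right.eq]
  have e2 : B * c'⁻¹ * A * B = B * c'⁻¹ * (A * c') * (c'⁻¹ * B) := by group
  rw [e1, e2]
  exact ⟨fun h => mul_left_cancel (mul_right_cancel h), fun h => by rw [h]⟩

/-- (R3) contains both ⟪y, x⟫ and ⟪x, y⁻¹⟫, which call for opposite orders of the two indices. In
this equivalent form only ⟪x, y⁻¹⟫ depends on the order, because the conjugations lie in every
triangular subgroup. -/
theorem conjEl_mul_conjEl {x y : Letter n} (h : x.1 ≠ y.1) :
    conjEl y x * conjEl x y * el x y.inv = el x y.inv * conjEl y x := by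
  refine (braid_iff (el_commute_conjEl y x)).1 ?_
  have h1 : conjEl x y * el x y.inv = el x.inv y := by
    rw [conjEl, el_inv_right]
    group
  have h2 : el y x * (conjEl y x)⁻¹ = el y.inv x.inv := by
    rw [el_inv_right, conjEl]
    group
  rw [h1, h2]
  exact el_braid h

/-- The hypotheses say `[A, P] = E = [A⁻¹, Q]`. Carrying `A` through `E Q P` gives `A E Q P = Q A P
= Q E P A = E Q P A`, so `A` commutes with `E (Q P)`, and `E` and `(Q P)⁻¹` conjugate `A` in the
same way. -/
theorem conj_eq_of_relations {G : Type*} [Group G] {A E P Q : G} (hEP : Commute E P)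
    (hEQ : Commute E Q) (hAP : A * P = E * P * A) (hAQ : A⁻¹ * Q = E * Q * A⁻¹) :
    E * A * E⁻¹ = (Q * P)⁻¹ * A * (Q * P) := by
  have hAQ' : Q * A = A * (E * Q) := by
    calc Q * A = A * (A⁻¹ * Q) * A := by group
      _ = A * (E * Q) := by rw [hAQ]; group
  have key : A * (E * (Q * P)) = E * (Q * P) * A := by
    calc A * (E * (Q * P)) = A * (E * Q) * P := by group
      _ = Q * (A * P) := by rw [← hAQ']; group
      _ = (Q * E) * P * A := by rw [hAP]; group
      _ = E * (Q * P) * A := by rw [← hEQ.eq]; group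
  have hE : E * (Q * P) = Q * P * E := (hEQ.mul_right hEP).eq
  calc E * A * E⁻¹ = (Q * P)⁻¹ * (Q * P * E * A) * E⁻¹ := by group
    _ = (Q * P)⁻¹ * (A * (Q * P * E)) * E⁻¹ := by rw [← hE, key]
    _ = (Q * P)⁻¹ * A * (Q * P) := by group

/-- This is the case `x' = x` that (R1) leaves out. It follows from (R2) for the middle letters `z`
and `z⁻¹` together. -/
theorem el_conj_el {x y z : Letter n} (hxy : x.1 ≠ y.1) (hzy : z.1 ≠ y.1) (hxz : x.1 ≠ z.1) :
    el x y * el x z * (el x y)⁻¹ = (conjEl z y)⁻¹ * el x z * conjEl z y := by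
  refine conj_eq_of_relations ?_ ?_ ?_ ?_
  · exact el_commute hzy (fun e => hxz (by rw [e])) hxy
  · exact el_commute hzy (fun e => hxz (by rw [← e]; rfl)) hxy
  · exact el_mul_el hxz hzy hxy
  · rw [← el_inv_right]
    exact el_mul_el (y := z.inv) hxz hzy hxy

/-- By (R2), moving ⟪x, y⟫ past each factor ⟪z^{±1}, x⟫ leaves ⟪z^{±1}, y⟫⁻¹ behind; (R1) collects
the two leftovers into a conjugation of `z`. -/
theorem el_conj_conjEl {x y z : Letter n} (hxy : x.1 ≠ y.1) (hzy : z.1 ≠ y.1) (hxz : x.1 ≠ z.1) :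
    el x y * conjEl z x * (el x y)⁻¹ = (conjEl z y)⁻¹ * conjEl z x := by
  have key : ∀ w : Letter n, w.1 = z.1 → el x y * el w x = (el w y)⁻¹ * el w x * el x y := by
    intro w hw
    have := el_mul_el (x := w) (y := x) (z := y) (hw ▸ hxz.symm) hxy (hw ▸ hzy)
    rw [mul_assoc _ (el w x), this]
    group
  have hcomm : Commute (el z.inv x) (el z y) :=
    el_commute hxz.symm z.ne_inv hzy
  calc el x y * conjEl z x * (el x y)⁻¹
      = el x y * el z.inv x * el z x * (el x y)⁻¹ := by rw [conjEl]; group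
    _ = (el z.inv y)⁻¹ * el z.inv x * (el x y * el z x) * (el x y)⁻¹ := by
        rw [key z.inv rfl]
        group
    _ = (el z.inv y)⁻¹ * (el z.inv x * (el z y)⁻¹) * el z x := by
        rw [key z rfl]
        group
    _ = (conjEl z y)⁻¹ * conjEl z x := by
        rw [hcomm.inv_right.eq, conjEl, conjEl, (el_inv_commute z y).eq]
        group

/-! ### The subgroups normalized by the letters of other indices -/

/-- The subgroup generated by all `⟪x, z⟫` and all conjugations of `z`, for a fixed index `z`. -/
def lowerSubgroup (z : Fin n) : Subgroup (StNn n) :=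
  Subgroup.closure ({g | ∃ x : Letter n, x.1 ≠ z ∧ g = el x (z, true)} ∪
    {g | ∃ y : Letter n, y.1 ≠ z ∧ g = conjEl (z, true) y})

/-- The subgroup generated by all `⟪z^{±1}, y⟫`, for a fixed index `z`. -/
def upperSubgroup (z : Fin n) : Subgroup (StNn n) :=
  Subgroup.closure {g | ∃ (b : Bool) (y : Letter n), y.1 ≠ z ∧ g = el (z, b) y}

theorem el_mem_lowerSubgroup {z : Fin n} {x : Letter n} (hx : x.1 ≠ z) (b : Bool) :
    el x (z, b) ∈ lowerSubgroup z := by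
  have : el x (z, true) ∈ lowerSubgroup z := Subgroup.subset_closure (Or.inl ⟨x, hx, rfl⟩)
  cases b
  · rw [show ((z, false) : Letter n) = Letter.inv (z, true) from rfl, el_inv_right]
    exact inv_mem this
  · exact this

theorem conjEl_mem_lowerSubgroup {z : Fin n} {y : Letter n} (hy : y.1 ≠ z) :
    conjEl (z, true) y ∈ lowerSubgroup z :=
  Subgroup.subset_closure (Or.inr ⟨y, hy, rfl⟩)

theorem el_mem_upperSubgroup {z : Fin n} {y : Letter n} (hy : y.1 ≠ z) (b : Bool) :
    el (z, b) y ∈ upperSubgroup z :=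
  Subgroup.subset_closure ⟨b, y, hy, rfl⟩

/-- Both conditions are needed, since conjugation by `a` alone could map the subgroup onto a proper
part of itself. -/
theorem mem_normalizer_closure {G : Type*} [Group G] {S : Set G} {a : G}
    (h : ∀ u ∈ S, a * u * a⁻¹ ∈ Subgroup.closure S)
    (h' : ∀ u ∈ S, a⁻¹ * u * a ∈ Subgroup.closure S) :
    a ∈ Subgroup.normalizer (Subgroup.closure S : Set G) := by
  have key : ∀ b : G, (∀ u ∈ S, b * u * b⁻¹ ∈ Subgroup.closure S) →
      ∀ u ∈ Subgroup.closure S, b * u * b⁻¹ ∈ Subgroup.closure S := by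
    intro b hb u hu
    have : Subgroup.closure S ≤ (Subgroup.closure S).comap (MulAut.conj b).toMonoidHom :=
      (Subgroup.closure_le _).2 hb
    exact this hu
  refine Subgroup.mem_normalizer_iff.2 fun u => ⟨key a h u, fun hu => ?_⟩
  have := key a⁻¹ (by simpa using h') _ hu
  simpa [mul_assoc] using this

/-- Conjugating ⟪w, z⟫ by ⟪x, y⟫ is `el_conj_el` for `w = x`, (R2) for `w = y^{±1}` and trivial by
(R1) otherwise. Conjugating a conjugation of `z` by `w` is `el_conj_conjEl` for `w = x^{±1}` and
trivial by (R1) otherwise. The conjugations belong to the subgroup because the first case produces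
them. -/
theorem el_mem_normalizer_lowerSubgroup {z : Fin n} {x y : Letter n} (hxy : x.1 ≠ y.1)
    (hx : x.1 ≠ z) (hy : y.1 ≠ z) :
    el x y ∈ Subgroup.normalizer (lowerSubgroup z : Set (StNn n)) := by
  -- Stated for all `y`, so that it also covers the inverse ⟪x, y⟫⁻¹ = ⟪x, y⁻¹⟫.
  have key : ∀ y : Letter n, x.1 ≠ y.1 → y.1 ≠ z →
      ∀ u ∈ ({g | ∃ x : Letter n, x.1 ≠ z ∧ g = el x (z, true)} ∪
        {g | ∃ y : Letter n, y.1 ≠ z ∧ g = conjEl (z, true) y} : Set (StNn n)),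
      el x y * u * (el x y)⁻¹ ∈ lowerSubgroup z := by
    intro y hxy hy
    have hxz : el x y * el x (z, true) * (el x y)⁻¹ ∈ lowerSubgroup z := by
      rw [el_conj_el (z := (z, true)) hxy hy.symm hx]
      exact mul_mem (mul_mem (inv_mem (conjEl_mem_lowerSubgroup hy)) (el_mem_lowerSubgroup hx _))
        (conjEl_mem_lowerSubgroup hy)
    have hcx : el x y * conjEl (z, true) x * (el x y)⁻¹ ∈ lowerSubgroup z := by
      rw [el_conj_conjEl (z := (z, true)) hxy hy.symm hx]
      exact mul_mem (inv_mem (conjEl_mem_lowerSubgroup hy)) (conjEl_mem_lowerSubgroup hx)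
    rintro _ (⟨w, hw, rfl⟩ | ⟨w, hw, rfl⟩)
    · by_cases hwx : w = x
      · rwa [hwx]
      by_cases hwy : w.1 = y.1
      · rcases Letter.eq_or_eq_inv hwy with rfl | rfl
        · rw [el_mul_el (z := (z, true)) hxy hy hx, mul_inv_cancel_right]
          exact mul_mem (el_mem_lowerSubgroup hx _) (el_mem_lowerSubgroup hy _)
        · have := el_mul_el (x := x) (y := y.inv) (z := (z, true)) hxy hy hx
          rw [el_inv_right x y] at this
          have e : el x y * el y.inv (z, true) * (el x y)⁻¹ =
              (el x y * el x (z, true) * (el x y)⁻¹)⁻¹ * el y.inv (z, true) := by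
            have : el y.inv (z, true) =
                el x y * (el x (z, true) * el y.inv (z, true) * (el x y)⁻¹) := by
              rw [← this]
              group
            conv_rhs => rw [this]
            group
          rw [e]
          exact mul_mem (inv_mem hxz) (el_mem_lowerSubgroup hw _)
      · rw [(el_commute (y' := (z, true)) hwy hwx hx).eq, mul_inv_cancel_right]
        exact el_mem_lowerSubgroup hw _
    · by_cases hwx : w.1 = x.1
      · rcases Letter.eq_or_eq_inv hwx with rfl | rfl
        · exact hcx
        · rw [conjEl_inv_right]
          have := inv_mem hcx
          rwa [mul_inv_rev, mul_inv_rev, inv_inv, ← mul_assoc] at this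
      · have hc : ∀ b, Commute (el x y) (el (z, b) w) := fun b =>
          el_commute hy.symm (fun e => hx (by rw [← e])) (Ne.symm hwx)
        have : Commute (el x y) (conjEl (z, true) w) := (hc false).mul_right (hc true)
        rw [this.eq, mul_inv_cancel_right]
        exact conjEl_mem_lowerSubgroup hw
  refine mem_normalizer_closure (key y hxy hy) fun u hu => ?_
  have := key y.inv hxy hy u hu
  rwa [el_inv_right, inv_inv] at this

/-- Here only ⟪z^{±1}, x^{±1}⟫ fails to commute with ⟪x, y⟫, and (R2) expresses its conjugate by
elements of the subgroup. -/
theorem el_mem_normalizer_upperSubgroup {z : Fin n} {x y : Letter n} (hxy : x.1 ≠ y.1)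
    (hx : x.1 ≠ z) (hy : y.1 ≠ z) :
    el x y ∈ Subgroup.normalizer (upperSubgroup z : Set (StNn n)) := by
  have key : ∀ y : Letter n, x.1 ≠ y.1 → y.1 ≠ z →
      ∀ u ∈ ({g | ∃ (b : Bool) (y : Letter n), y.1 ≠ z ∧ g = el (z, b) y} : Set (StNn n)),
      el x y * u * (el x y)⁻¹ ∈ upperSubgroup z := by
    rintro y hxy hy _ ⟨b, w, hw, rfl⟩
    have hzx : el x y * el (z, b) x * (el x y)⁻¹ ∈ upperSubgroup z := by
      have h := el_mul_el (x := (z, b)) hx.symm hxy hy.symm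
      have : el x y * el (z, b) x * (el x y)⁻¹ = (el (z, b) y)⁻¹ * el (z, b) x := by
        rw [mul_inv_eq_iff_eq_mul, mul_assoc _ (el (z, b) x), h]
        group
      rw [this]
      exact mul_mem (inv_mem (el_mem_upperSubgroup hy b)) (el_mem_upperSubgroup hx b)
    by_cases hwx : w.1 = x.1
    · rcases Letter.eq_or_eq_inv hwx with rfl | rfl
      · exact hzx
      · rw [el_inv_right]
        have := inv_mem hzx
        rwa [mul_inv_rev, mul_inv_rev, inv_inv, ← mul_assoc] at this
    · rw [(el_commute (x' := (z, b)) hy.symm (fun e => hx (by rw [← e])) (Ne.symm hwx)).eq,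
        mul_inv_cancel_right]
      exact el_mem_upperSubgroup hw b
  refine mem_normalizer_closure (key y hxy hy) fun u hu => ?_
  have := key y.inv hxy hy u hu
  rwa [el_inv_right, inv_inv] at this

/-! ### Triangular subgroups -/

theorem el_mem_triangular {s : PartialOrder (Fin n)} {x y : Letter n} (h : s.lt y.1 x.1) :
    el x y ∈ triangular s := by
  have hne : x.1 ≠ y.1 := fun e => @lt_irrefl _ s.toPreorder y.1 (by rwa [e] at h)
  have key : el x (y.1, true) ∈ triangular s :=
    Subgroup.subset_closure (Or.inl ⟨x.1, y.1, x.2, indep_iff.2 hne, h, el_of_indep _⟩)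
  rcases Letter.eq_or_eq_inv (x := y) (y := (y.1, true)) rfl with e | e
  · rw [e]
    exact key
  · rw [e, el_inv_right]
    exact inv_mem key

theorem conjEl_mem_triangular (s : PartialOrder (Fin n)) {x y : Letter n} (h : x.1 ≠ y.1) :
    conjEl x y ∈ triangular s := by
  have key : conjEl (x.1, true) (y.1, true) ∈ triangular s :=
    Subgroup.subset_closure (Or.inr ⟨x.1, y.1, indep_iff.2 h, indep_iff.2 h, by
      rw [conjEl, ← el_of_indep, ← el_of_indep]
      rfl⟩)
  have key' : conjEl x (y.1, true) ∈ triangular s := by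
    rcases Letter.eq_or_eq_inv (x := x) (y := (x.1, true)) rfl with e | e
    · rw [e]
      exact key
    · rw [e, conjEl_inv_left]
      exact key
  rcases Letter.eq_or_eq_inv (x := y) (y := (y.1, true)) rfl with e | e
  · rw [e]
    exact key'
  · rw [e, conjEl_inv_right]
    exact inv_mem key'

theorem triangular_le {s : PartialOrder (Fin n)} {H : Subgroup (StNn n)}
    (h₁ : ∀ x y : Letter n, s.lt y.1 x.1 → el x y ∈ H)
    (h₂ : ∀ x y : Letter n, x.1 ≠ y.1 → conjEl x y ∈ H) : triangular s ≤ H := by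
  refine (Subgroup.closure_le _).2 ?_
  rintro _ (⟨i, j, b, h, hlt, rfl⟩ | ⟨i, j, h, h', rfl⟩)
  · rw [← el_of_indep]
    exact h₁ _ _ hlt
  · rw [← el_of_indep, ← el_of_indep]
    exact h₂ (i, true) (j, true) (indep_iff.1 h')

/-- The partial order of a rank function. -/
abbrev rankOrder (r : Fin n → ℕ) : PartialOrder (Fin n) :=
  have : IsStrictOrder (Fin n) fun i j => r i < r j :=
    { irrefl := fun _ => lt_irrefl _, trans := fun _ _ _ => lt_trans }
  partialOrderOfSO fun i j => r i < r j

theorem lt_rankOrder {r : Fin n → ℕ} {i j : Fin n} : (rankOrder r).lt i j ↔ r i < r j := Iff.rfl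

/-- This and the next two lemmas provide orders for which all generators in an instance of (R0),
(R1) or (R2) are triangular at once. -/
theorem exists_order {i j : Fin n} (h : i ≠ j) : ∃ s : PartialOrder (Fin n), s.lt j i :=
  ⟨rankOrder fun k => if k = i then 1 else 0, lt_rankOrder.2 (by simp [h.symm])⟩

theorem exists_order_two {i j i' j' : Fin n} (h : i ≠ j) (h' : i' ≠ j') (h₁ : i' ≠ j)
    (h₂ : i ≠ j') : ∃ s : PartialOrder (Fin n), s.lt j i ∧ s.lt j' i' :=
  -- Rank `1` for `i, i'` and `0` for the rest works exactly because the side conditions of (R1)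
  -- keep `j, j'` apart from `i, i'`.
  ⟨rankOrder fun k => if k = i ∨ k = i' then 1 else 0,
    lt_rankOrder.2 (by simp [h.symm, h₁.symm]), lt_rankOrder.2 (by simp [h'.symm, h₂.symm])⟩

theorem exists_order_chain {i j k : Fin n} (hij : i ≠ j) (hjk : j ≠ k) (hik : i ≠ k) :
    ∃ s : PartialOrder (Fin n), s.lt j i ∧ s.lt k j ∧ s.lt k i :=
  ⟨rankOrder fun l => if l = i then 2 else if l = j then 1 else 0,
    lt_rankOrder.2 (by simp [hij.symm]), lt_rankOrder.2 (by simp [hij.symm, hjk.symm, hik.symm]),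
    lt_rankOrder.2 (by simp [hjk.symm, hik.symm])⟩

/-! ### Presentation of `StNₙ` as an amalgam -/

theorem stNn_hom_ext {Q : Type*} [Group Q] {φ ψ : StNn n →* Q}
    (h : ∀ x y : Letter n, x.1 ≠ y.1 → φ (el x y) = ψ (el x y)) : φ = ψ := by
  refine PresentedGroup.ext fun p => ?_
  have := h p.1.1 p.1.2 (indep_iff.1 p.2)
  rwa [el_of_indep p.2] at this

theorem stNn_eq_top {H : Subgroup (StNn n)}
    (h : ∀ x y : Letter n, x.1 ≠ y.1 → el x y ∈ H) : H = ⊤ := by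
  rw [eq_top_iff, ← PresentedGroup.closure_range_of, Subgroup.closure_le]
  rintro _ ⟨p, rfl⟩
  have := h p.1.1 p.1.2 (indep_iff.1 p.2)
  rwa [el_of_indep p.2] at this

/-- `StNₙ` is the amalgam of its triangular subgroups. -/
theorem exists_hom_of_mul_on_triangular {Q : Type*} [Group Q] (e : StNn n → Q)
    (he : ∀ s, ∀ a ∈ triangular s, ∀ b ∈ triangular s, e (a * b) = e a * e b) :
    ∃ φ : StNn n →* Q, ∀ s, ∀ a ∈ triangular s, φ a = e a := by
  have e_one : ∀ s : PartialOrder (Fin n), e 1 = 1 := fun s => by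
    have := he s 1 (one_mem _) 1 (one_mem _)
    rwa [one_mul, left_eq_mul] at this
  have e_inv : ∀ s, ∀ a ∈ triangular s, e a⁻¹ = (e a)⁻¹ := fun s a ha => by
    have := he s a⁻¹ (inv_mem ha) a ha
    rw [inv_mul_cancel, e_one s] at this
    exact eq_inv_of_mul_eq_one_left this.symm
  let f : Gen n → Q := fun p => e (el p.1.1 p.1.2)
  have hf : ∀ x y h, FreeGroup.lift f (StNGroup.gen x y h) = e (el x y) := fun x y h => by
    rw [StNGroup.gen, FreeGroup.lift_apply_of]
  have hrel : ∀ r ∈ {r | Rel n r}, FreeGroup.lift f r = 1 := by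
    intro r hr
    cases hr with
    | r0 x y h h' =>
      obtain ⟨s, hs⟩ := exists_order (indep_iff.1 h)
      rw [map_mul, hf, hf, el_inv_right, e_inv s _ (el_mem_triangular hs), inv_mul_cancel]
    | r1 x y x' y' h h' h₁ h₂ h₃ =>
      obtain ⟨s, hs, hs'⟩ := exists_order_two (indep_iff.1 h) (indep_iff.1 h') (indep_iff.1 h₁)
        (indep_iff.1 h₃)
      simp only [comm, map_mul, map_inv, hf]
      rw [← he s _ (el_mem_triangular hs) _ (el_mem_triangular hs'),
        (el_commute (indep_iff.1 h₁) h₂ (indep_iff.1 h₃)).eq,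
        he s _ (el_mem_triangular hs') _ (el_mem_triangular hs)]
      group
    | r2 x y z hxy hyz hxz =>
      obtain ⟨s, h₁, h₂, h₃⟩ := exists_order_chain (indep_iff.1 hxy) (indep_iff.1 hyz)
        (indep_iff.1 hxz)
      simp only [comm, map_mul, map_inv, hf]
      have m₁ := el_mem_triangular h₁
      have m₂ := el_mem_triangular h₂
      have m₃ := el_mem_triangular h₃
      rw [← he s _ m₁ _ m₂, el_mul_el (indep_iff.1 hxy) (indep_iff.1 hyz) (indep_iff.1 hxz),
        he s _ (mul_mem m₃ m₂) _ m₁, he s _ m₃ _ m₂]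
      group
    | r3 x y h₁ h₂ h₃ h₄ =>
      have hxy : x.1 ≠ y.1 := (indep_iff.1 h₁).symm
      simp only [map_mul, map_inv, hf]
      rw [mul_inv_eq_one]
      -- Two opposite orders: `s` serves ⟪x, y⁻¹⟫ and `s'` serves ⟪y, x⟫. The conjugations are in
      -- both subgroups, so `e` may be evaluated piece by piece.
      obtain ⟨s, hs⟩ := exists_order hxy
      obtain ⟨s', hs'⟩ := exists_order hxy.symm
      have mA : el x y.inv ∈ triangular s := el_mem_triangular hs
      have mB : el y x ∈ triangular s' := el_mem_triangular hs'
      have mc := conjEl_mem_triangular s hxy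
      have mc' := fun s => conjEl_mem_triangular s hxy.symm
      have e₁ : e (el x.inv y) = e (conjEl x y) * e (el x y.inv) := by
        rw [← he s _ mc _ mA, conjEl, el_inv_right, mul_inv_cancel_right]
      have e₂ : e (el y.inv x.inv) = e (el y x) * (e (conjEl y x))⁻¹ := by
        rw [← e_inv s' _ (mc' s'), ← he s' _ mB _ (inv_mem (mc' s')), el_inv_right, conjEl]
        congr 1
        group
      rw [e₁, e₂]
      refine (braid_iff ?_).2 ?_
      · rw [Commute, SemiconjBy, ← he s' _ mB _ (mc' s'), (el_commute_conjEl y x).eq,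
          he s' _ (mc' s') _ mB]
      · rw [← he s _ (mc' s) _ mc, ← he s _ (mul_mem (mc' s) mc) _ mA, conjEl_mul_conjEl hxy,
          he s _ mA _ (mc' s)]
  let φ : StNn n →* Q := PresentedGroup.toGroup hrel
  have hφ : ∀ x y : Letter n, x.1 ≠ y.1 → φ (el x y) = e (el x y) := fun x y h => by
    rw [el_of_indep (indep_iff.2 h)]
    refine (PresentedGroup.toGroup.of hrel).trans ?_
    rw [← el_of_indep (indep_iff.2 h)]
  refine ⟨φ, fun s a ha => ?_⟩
  let H : Subgroup (StNn n) :=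
    { carrier := {a | a ∈ triangular s ∧ φ a = e a}
      mul_mem' := fun {a b} ha hb =>
        ⟨mul_mem ha.1 hb.1, by rw [map_mul, ha.2, hb.2, he s _ ha.1 _ hb.1]⟩
      one_mem' := ⟨one_mem _, by rw [map_one, e_one s]⟩
      inv_mem' := fun {a} ha => ⟨inv_mem ha.1, by rw [map_inv, ha.2, e_inv s _ ha.1]⟩ }
  have : triangular s ≤ H := by
    refine triangular_le (fun x y h => ?_) fun x y h => ?_
    · have hne : x.1 ≠ y.1 := fun e => @lt_irrefl _ s.toPreorder y.1 (by rwa [e] at h)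
      exact ⟨el_mem_triangular h, hφ x y hne⟩
    · obtain ⟨s', hs'⟩ := exists_order h
      refine ⟨conjEl_mem_triangular s h, ?_⟩
      rw [conjEl, map_mul, hφ _ _ h, hφ _ _ (show x.inv.1 ≠ y.1 from h),
        ← he s' _ (el_mem_triangular (x := x.inv) hs') _ (el_mem_triangular hs')]
  exact (this ha).2

end StNGroup

/-! ## The stable group -/

namespace StNGroup

open StNn

theorem toStN_stab {n m : ℕ} (h : n ≤ m) (a : StNn n) : toStN m (stab n m h a) = toStN n a :=
  DirectLimit.mk_apply (f := stab) n m a h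

theorem stab_el {n m : ℕ} (h : n ≤ m) (x y : Letter n) :
    stab n m h (el x y) = el (x.cast h) (y.cast h) := by
  by_cases hxy : Indep x y
  · rw [el_of_indep hxy, el_of_indep (hxy.cast h)]
    change PresentedGroup.mk _ (FreeGroup.map (Gen.cast h) (FreeGroup.of _)) = _
    rw [FreeGroup.map.of]
    rfl
  · have e : x.1 = y.1 := by
      by_contra hne
      exact hxy (indep_iff.2 hne)
    rw [el_of_eq e, map_one, el_of_eq]
    exact congrArg (Fin.castLE h) e

theorem toStN_el {n m : ℕ} (h : n ≤ m) (x y : Letter n) :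
    toStN n (el x y) = toStN m (el (x.cast h) (y.cast h)) := by
  rw [← stab_el, toStN_stab]

theorem range_toStN_mono {n m : ℕ} (h : n ≤ m) : (toStN n).range ≤ (toStN m).range := by
  rintro _ ⟨a, rfl⟩
  exact ⟨stab n m h a, toStN_stab h a⟩

theorem exists_mem_range_toStN (g : StN) : ∃ n, g ∈ (toStN n).range := by
  obtain ⟨n, a, rfl⟩ := DirectLimit.exists_eq_mk stab g
  exact ⟨n, a, rfl⟩

/-- The stable group is generated by the generators of sufficiently late stages. -/
theorem stN_eq_top (N : ℕ) {H : Subgroup StN}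
    (h : ∀ n, N ≤ n → ∀ x y : Letter n, x.1 ≠ y.1 → toStN n (el x y) ∈ H) : H = ⊤ := by
  rw [eq_top_iff]
  intro g _
  obtain ⟨n, hn⟩ := exists_mem_range_toStN g
  obtain ⟨a, rfl⟩ := range_toStN_mono (le_max_left n N) hn
  have : H.comap (toStN (max n N)) = ⊤ := stNn_eq_top (h _ (le_max_right _ _))
  exact (this ▸ Subgroup.mem_top a : a ∈ H.comap (toStN (max n N)))

theorem mem_stableTriangular {n : ℕ} {s : PartialOrder (Fin n)} {a : StNn n}
    (h : a ∈ triangular s) : toStN n a ∈ stableTriangular ⟨n, s⟩ :=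
  Subgroup.mem_map_of_mem _ h

/-- The stable group is the amalgam of its triangular subgroups. -/
theorem exists_hom_of_mul_on_stableTriangular {Q : Type*} [Group Q] (e : StN → Q)
    (he : ∀ p, ∀ a ∈ stableTriangular p, ∀ b ∈ stableTriangular p, e (a * b) = e a * e b) :
    ∃ φ : StN →* Q, ∀ p, ∀ a ∈ stableTriangular p, φ a = e a := by
  have h := fun n => exists_hom_of_mul_on_triangular (fun a : StNn n => e (toStN n a))
    fun s a ha b hb => by
      rw [map_mul]
      exact he ⟨n, s⟩ _ (mem_stableTriangular ha) _ (mem_stableTriangular hb)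
  choose φ hφ using h
  have hel : ∀ n (x y : Letter n), x.1 ≠ y.1 → φ n (el x y) = e (toStN n (el x y)) := by
    intro n x y hxy
    obtain ⟨s, hs⟩ := exists_order hxy
    exact hφ n s _ (el_mem_triangular hs)
  have hcompat : ∀ n m (h : n ≤ m) (a : StNn n), φ n a = φ m (stab n m h a) := by
    intro n m h a
    have : φ n = (φ m).comp (stab n m h) := stNn_hom_ext fun x y hxy => by
      rw [MonoidHom.comp_apply, stab_el, hel n x y hxy, hel m _ _ (indep_iff.1
        ((indep_iff.2 hxy).cast h)), toStN_el h]
    exact DFunLike.congr_fun this a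
  let ψ : StN →* Q :=
    { toFun := DirectLimit.lift stab (fun n a => φ n a) hcompat
      map_one' := DirectLimit.lift_one (f := stab) φ hcompat
      map_mul' := DirectLimit.lift_mul (f := stab) φ hcompat }
  refine ⟨ψ, ?_⟩
  rintro ⟨n, s⟩ _ ⟨a, ha, rfl⟩
  exact hφ n s a ha

/-! ### Adding one index -/

/-- The image in the stable group of the lower subgroup of the last index. -/
def stableLower (N : ℕ) : Subgroup StN := (lowerSubgroup (Fin.last N)).map (toStN (N + 1))

/-- The image in the stable group of the upper subgroup of the last index. -/
def stableUpper (N : ℕ) : Subgroup StN := (upperSubgroup (Fin.last N)).map (toStN (N + 1))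

theorem cast_ne_last {m N : ℕ} (h : m ≤ N) (i : Fin m) :
    Fin.castLE (h.trans N.le_succ) i ≠ Fin.last N :=
  fun e => absurd (congrArg Fin.val e) (Nat.ne_of_lt (lt_of_lt_of_le i.2 h))

theorem range_stab_le_normalizer {N : ℕ} {K : Subgroup (StNn (N + 1))}
    (h : ∀ x y : Letter (N + 1), x.1 ≠ y.1 → x.1 ≠ Fin.last N → y.1 ≠ Fin.last N →
      el x y ∈ Subgroup.normalizer (K : Set (StNn (N + 1)))) (a : StNn N) :
    stab N (N + 1) N.le_succ a ∈ Subgroup.normalizer (K : Set (StNn (N + 1))) := by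
  have : (Subgroup.normalizer (K : Set (StNn (N + 1)))).comap (stab N (N + 1) N.le_succ) = ⊤ :=
    stNn_eq_top fun x y hxy => by
      rw [Subgroup.mem_comap, stab_el]
      exact h _ _ (indep_iff.1 ((indep_iff.2 hxy).cast _)) (cast_ne_last le_rfl _)
        (cast_ne_last le_rfl _)
  exact (this ▸ Subgroup.mem_top a :
    a ∈ (Subgroup.normalizer (K : Set (StNn (N + 1)))).comap (stab N (N + 1) N.le_succ))

theorem conj_mem_map {N : ℕ} {K : Subgroup (StNn (N + 1))}
    (h : ∀ x y : Letter (N + 1), x.1 ≠ y.1 → x.1 ≠ Fin.last N → y.1 ≠ Fin.last N →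
      el x y ∈ Subgroup.normalizer (K : Set (StNn (N + 1)))) {a u : StN}
    (ha : a ∈ (toStN N).range) (hu : u ∈ K.map (toStN (N + 1))) :
    a⁻¹ * u * a ∈ K.map (toStN (N + 1)) := by
  obtain ⟨a, rfl⟩ := ha
  obtain ⟨u, hu, rfl⟩ := hu
  rw [← toStN_stab N.le_succ, ← map_inv, ← map_mul, ← map_mul]
  refine Subgroup.mem_map_of_mem _ ?_
  have := (Subgroup.mem_normalizer_iff.1 (inv_mem (range_stab_le_normalizer h a)) u).1 hu
  rwa [inv_inv] at this

theorem conj_mem_stableLower {N : ℕ} {a u : StN} (ha : a ∈ (toStN N).range)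
    (hu : u ∈ stableLower N) : a⁻¹ * u * a ∈ stableLower N :=
  conj_mem_map (fun _ _ => el_mem_normalizer_lowerSubgroup) ha hu

theorem conj_mem_stableUpper {N : ℕ} {a u : StN} (ha : a ∈ (toStN N).range)
    (hu : u ∈ stableUpper N) : a⁻¹ * u * a ∈ stableUpper N :=
  conj_mem_map (fun _ _ => el_mem_normalizer_upperSubgroup) ha hu

/-- The relation `s`, transported to the first `m` of `N + 1` indices. -/
def extendLT {m N : ℕ} (h : m ≤ N) (s : PartialOrder (Fin m)) (i j : Fin (N + 1)) : Prop :=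
  ∃ i' j', i = Fin.castLE (h.trans N.le_succ) i' ∧ j = Fin.castLE (h.trans N.le_succ) j' ∧
    s.lt i' j'

theorem extendLT_irrefl {m N : ℕ} {h : m ≤ N} {s : PartialOrder (Fin m)} {i : Fin (N + 1)} :
    ¬ extendLT h s i i := by
  rintro ⟨i', j', hi, hj, hlt⟩
  have := Fin.castLE_injective _ (hi.symm.trans hj)
  subst this
  exact @lt_irrefl _ s.toPreorder _ hlt

theorem extendLT_trans {m N : ℕ} {h : m ≤ N} {s : PartialOrder (Fin m)} {i j k : Fin (N + 1)}
    (hij : extendLT h s i j) (hjk : extendLT h s j k) : extendLT h s i k := by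
  obtain ⟨i', j', hi, hj, hlt⟩ := hij
  obtain ⟨j'', k', hj', hk, hlt'⟩ := hjk
  have := Fin.castLE_injective _ (hj.symm.trans hj')
  subst this
  exact ⟨i', k', hi, hk, @lt_trans _ s.toPreorder _ _ _ hlt hlt'⟩

theorem extendLT_ne_last {m N : ℕ} {h : m ≤ N} {s : PartialOrder (Fin m)} {i j : Fin (N + 1)}
    (hij : extendLT h s i j) : i ≠ Fin.last N ∧ j ≠ Fin.last N := by
  obtain ⟨i', j', rfl, rfl, -⟩ := hij
  exact ⟨cast_ne_last h _, cast_ne_last h _⟩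

/-- The extension of an order by a smallest index. -/
abbrev orderWithBot {m N : ℕ} (h : m ≤ N) (s : PartialOrder (Fin m)) :
    PartialOrder (Fin (N + 1)) :=
  let r : Fin (N + 1) → Fin (N + 1) → Prop := fun i j =>
    (i = Fin.last N ∧ j ≠ Fin.last N) ∨ extendLT h s i j
  have : IsStrictOrder (Fin (N + 1)) r :=
    { irrefl := by
        rintro i (⟨h₁, h₂⟩ | h₁)
        exacts [h₂ h₁, extendLT_irrefl h₁]
      trans := by
        rintro i j k (⟨h₁, h₂⟩ | h₁) (⟨h₃, h₄⟩ | h₃)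
        exacts [absurd h₃ h₂, Or.inl ⟨h₁, (extendLT_ne_last h₃).2⟩,
          absurd h₃ (extendLT_ne_last h₁).2, Or.inr (extendLT_trans h₁ h₃)] }
  partialOrderOfSO r

/-- The extension of an order by a largest index. -/
abbrev orderWithTop {m N : ℕ} (h : m ≤ N) (s : PartialOrder (Fin m)) :
    PartialOrder (Fin (N + 1)) :=
  let r : Fin (N + 1) → Fin (N + 1) → Prop := fun i j =>
    (i ≠ Fin.last N ∧ j = Fin.last N) ∨ extendLT h s i j
  have : IsStrictOrder (Fin (N + 1)) r :=
    { irrefl := by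
        rintro i (⟨h₁, h₂⟩ | h₁)
        exacts [h₁ h₂, extendLT_irrefl h₁]
      trans := by
        rintro i j k (⟨h₁, h₂⟩ | h₁) (⟨h₃, h₄⟩ | h₃)
        exacts [absurd h₂ h₃, absurd h₂ (extendLT_ne_last h₃).1,
          Or.inl ⟨(extendLT_ne_last h₁).1, h₄⟩, Or.inr (extendLT_trans h₁ h₃)] }
  partialOrderOfSO r

/-- Comparisons in `s` carry over to `s'` by hypothesis, and the conjugations need no comparison. -/
theorem stableTriangular_le {m n : ℕ} (h : m ≤ n) {s : PartialOrder (Fin m)}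
    {s' : PartialOrder (Fin n)}
    (hs : ∀ i j, s.lt i j → s'.lt (Fin.castLE h i) (Fin.castLE h j)) :
    stableTriangular ⟨m, s⟩ ≤ stableTriangular ⟨n, s'⟩ := by
  rintro _ ⟨a, ha, rfl⟩
  rw [← toStN_stab h]
  refine mem_stableTriangular ?_
  have : triangular s ≤ (triangular s').comap (stab m n h) := by
    refine triangular_le (fun x y hxy => ?_) fun x y hxy => ?_
    · rw [Subgroup.mem_comap, stab_el]
      exact el_mem_triangular (hs _ _ hxy)
    · rw [Subgroup.mem_comap, conjEl, map_mul, stab_el, stab_el]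
      exact conjEl_mem_triangular s' (indep_iff.1 ((indep_iff.2 hxy).cast h))
  exact this ha

/-- Making the new index smallest turns every ⟪x, z⟫ into a triangular generator; the conjugations
of `z` are triangular for any order. -/
theorem exists_stableTriangular_lower {m N : ℕ} (h : m ≤ N) (s : PartialOrder (Fin m)) :
    ∃ p, stableTriangular ⟨m, s⟩ ≤ stableTriangular p ∧ stableLower N ≤ stableTriangular p := by
  refine ⟨⟨N + 1, orderWithBot h s⟩, stableTriangular_le (h.trans N.le_succ)
    fun i j hij => Or.inr ⟨i, j, rfl, rfl, hij⟩, Subgroup.map_mono ?_⟩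
  refine (Subgroup.closure_le _).2 ?_
  rintro _ (⟨x, hx, rfl⟩ | ⟨y, hy, rfl⟩)
  · exact el_mem_triangular (Or.inl ⟨rfl, hx⟩)
  · exact conjEl_mem_triangular _ hy.symm

/-- Making the new index largest turns every ⟪z^{±1}, y⟫ into a triangular generator. -/
theorem exists_stableTriangular_upper {m N : ℕ} (h : m ≤ N) (s : PartialOrder (Fin m)) :
    ∃ p, stableTriangular ⟨m, s⟩ ≤ stableTriangular p ∧ stableUpper N ≤ stableTriangular p := by
  refine ⟨⟨N + 1, orderWithTop h s⟩, stableTriangular_le (h.trans N.le_succ)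
    fun i j hij => Or.inr ⟨i, j, rfl, rfl, hij⟩, Subgroup.map_mono ?_⟩
  refine (Subgroup.closure_le _).2 ?_
  rintro _ ⟨b, y, hy, rfl⟩
  exact el_mem_triangular (Or.inl ⟨hy, rfl⟩)

/-- Every generator is a commutator of an element of the lower and one of the upper subgroup. -/
theorem exists_commutator {N : ℕ} {x y : Letter N} (hxy : x.1 ≠ y.1) :
    ∃ u ∈ stableLower N, ∃ v ∈ stableUpper N, toStN N (el x y) = u * v * u⁻¹ * v⁻¹ := by
  have hx := cast_ne_last (le_refl N) x.1
  have hy := cast_ne_last (le_refl N) y.1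
  refine ⟨toStN (N + 1) (el (x.cast N.le_succ) (Fin.last N, true)),
    Subgroup.mem_map_of_mem _ (el_mem_lowerSubgroup hx _),
    toStN (N + 1) (el (Fin.last N, true) (y.cast N.le_succ)),
    Subgroup.mem_map_of_mem _ (el_mem_upperSubgroup hy _), ?_⟩
  rw [toStN_el N.le_succ, el_commutator (y := (Fin.last N, true)) hx hy.symm
    (indep_iff.1 ((indep_iff.2 hxy).cast _))]
  simp only [map_mul, map_inv]

end StNGroup

/-! ## Simple connectivity of `V_op(G, {Gᵢ})` for an amalgam -/

/-- A space is simply connected if it has an open cover and a family of homotopy classes of paths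
from a base point which is compatible with all paths inside a member of the cover. -/
theorem simplyConnectedSpace_of_compatible {X ι : Type*} [TopologicalSpace X] {x₀ : X}
    (κ : ∀ q, Path.Homotopic.Quotient x₀ q) (U : ι → Set X) (hU : ∀ i, IsOpen (U i))
    (hcov : ⋃ i, U i = Set.univ)
    (hκ : ∀ i p q (δ : Path p q), (∀ t, δ t ∈ U i) → (κ p).trans (.mk δ) = κ q) :
    SimplyConnectedSpace X := by
  have key : ∀ p q (γ : Path p q), (κ p).trans (.mk γ) = κ q := by
    rintro _ _ ⟨f, rfl, rfl⟩
    let γ : Path (f 0) (f 1) := ⟨f, rfl, rfl⟩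
    -- Lebesgue subdivision: each piece of the path lies in one member of the cover, so
    -- compatibility propagates by induction along the pieces.
    obtain ⟨t, ht0, hmono, ⟨N, hN⟩, hsub⟩ :=
      exists_monotone_Icc_subset_open_cover_unitInterval (c := fun i => f ⁻¹' U i)
        (fun i => (hU i).preimage f.continuous)
        (by rw [← Set.preimage_iUnion, hcov, Set.preimage_univ])
    have h0 : ∀ s : I, s = 0 → (κ (γ 0)).trans (.mk (γ.subpath 0 s)) = κ (γ s) := by
      rintro _ rfl
      rw [Path.subpath_self, Path.Homotopic.Quotient.mk_refl, Path.Homotopic.Quotient.trans_refl]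
    have hn : ∀ n, (κ (γ 0)).trans (.mk (γ.subpath 0 (t n))) = κ (γ (t n)) := by
      intro n
      induction n with
      | zero => exact h0 _ ht0
      | succ n ih =>
        obtain ⟨i, hi⟩ := hsub n
        have hs : Path.Homotopic.Quotient.mk (γ.subpath 0 (t (n + 1))) =
            (Path.Homotopic.Quotient.mk (γ.subpath 0 (t n))).trans
              (.mk (γ.subpath (t n) (t (n + 1)))) := by
          rw [← Path.Homotopic.Quotient.mk_trans]
          exact Path.Homotopic.Quotient.eq.2 ⟨(Path.Homotopy.subpathTransSubpath γ _ _ _).symm⟩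
        rw [hs, ← Path.Homotopic.Quotient.trans_assoc, ih]
        refine hκ i _ _ _ fun s => ?_
        obtain ⟨r, hr, hrs⟩ := (Path.range_subpath_of_le γ _ _ (hmono n.le_succ)).subset ⟨s, rfl⟩
        rw [← hrs]
        exact hi hr
    have h1 : ∀ s : I, s = 1 → (κ (γ 0)).trans (.mk (γ.subpath 0 s)) = κ (γ s) →
        (κ (f 0)).trans (.mk γ) = κ (f 1) := by
      rintro _ rfl h
      rw [Path.subpath_zero_one] at h
      exact h
    exact h1 _ (hN N le_rfl) (hn N)
  -- Every path from `x` to `y` is now in the class of `κ x` reversed followed by `κ y`.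
  refine (simply_connected_iff_unique_homotopic X).2 ⟨⟨x₀⟩, fun x y =>
    ⟨⟨⟨(κ x).symm.trans (κ y)⟩, fun a => ?_⟩⟩⟩
  obtain ⟨γ, rfl⟩ := Path.Homotopic.Quotient.mk_surjective a
  change _ = (κ x).symm.trans (κ y)
  rw [← key x y γ, ← Path.Homotopic.Quotient.trans_assoc, Path.Homotopic.Quotient.symm_trans,
    Path.Homotopic.Quotient.refl_trans]

namespace Vop

open Realization

variable {G : Type} [Group G] {ι : Type} {S : ι → Subgroup G}

/-- The vertex `g` of the realization. -/
def vert [Nonempty ι] (S : ι → Subgroup G) (g : G) : Realization (Vop G S) :=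
  vertex g ⟨Finset.singleton_nonempty g, Classical.arbitrary ι, by simp [one_mem]⟩

theorem support_vert [Nonempty ι] (g : G) : (vert S g).weight.support = {g} :=
  support_vertex _ _

theorem exists_face {a b c : G} {i : ι} (hab : a⁻¹ * b ∈ S i) (hbc : b⁻¹ * c ∈ S i) :
    ∃ s ∈ (Vop G S).faces, a ∈ s ∧ b ∈ s ∧ c ∈ s := by
  classical
  have h : ∀ d ∈ ({a, b, c} : Finset G), a⁻¹ * d ∈ S i := by
    intro d hd
    simp only [Finset.mem_insert, Finset.mem_singleton] at hd
    rcases hd with rfl | rfl | rfl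
    · simp [one_mem]
    · exact hab
    · simpa [mul_assoc] using mul_mem hab hbc
  refine ⟨{a, b, c}, ⟨⟨a, by simp⟩, i, fun d hd d' hd' => ?_⟩, by simp, by simp, by simp⟩
  simpa [mul_assoc] using mul_mem (inv_mem (h d hd)) (h d' hd')

theorem contiguous_vert [Nonempty ι] {a b : G} (h : ∃ i, a⁻¹ * b ∈ S i) :
    Contiguous (vert S a) (vert S b) := by
  obtain ⟨i, hi⟩ := h
  obtain ⟨s, hs, ha, hb, -⟩ := exists_face (c := b) hi (by simp [one_mem])
  refine ⟨s, hs, ?_, ?_⟩ <;> rw [support_vert] <;> simpa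

/-- The class of the edge from `a` to `b`. -/
def edge [Nonempty ι] {a b : G} (h : ∃ i, a⁻¹ * b ∈ S i) :
    Path.Homotopic.Quotient (vert S a) (vert S b) :=
  .mk (line (contiguous_vert h))

/-- Since both edges come from the same subgroup, `a, b, c` span a simplex. The class of the third
edge does not depend on the subgroup that witnesses it. -/
theorem edge_trans_edge [Nonempty ι] {a b c : G} {i : ι} (hab : a⁻¹ * b ∈ S i)
    (hbc : b⁻¹ * c ∈ S i) (hac : ∃ i, a⁻¹ * c ∈ S i) :
    (edge ⟨i, hab⟩).trans (edge ⟨i, hbc⟩) = edge hac := by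
  obtain ⟨s, hs, ha, hb, hc⟩ := exists_face hab hbc
  refine line_trans_line hs ?_ ?_ ?_ _ _ _ <;> rw [support_vert] <;> simpa

theorem edge_self [Nonempty ι] {a : G} (h : ∃ i, a⁻¹ * a ∈ S i) :
    edge h = .refl (vert S a) := by
  rw [edge, line_self, Path.Homotopic.Quotient.mk_refl]

/-! ### The action of an amalgam on paths from the base vertex -/

/-- The vertices, together with a homotopy class of paths from the vertex `1`. -/
abbrev PathVertex [Nonempty ι] (S : ι → Subgroup G) : Type :=
  Σ g : G, Path.Homotopic.Quotient (vert S 1) (vert S g)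

open scoped Classical in
/-- Prolongation of a path by the edge from `g` to `g t`. -/
def step [Nonempty ι] (t : G) (x : PathVertex S) : PathVertex S :=
  if h : ∃ i, t ∈ S i then ⟨x.1 * t, x.2.trans (edge (by simpa using h))⟩ else x

/-- The end point `b` is a variable, so that equal but differently written end points cause no
transport of path classes. -/
theorem step_eq [Nonempty ι] {t a b : G} (h : ∃ i, t ∈ S i)
    (p : Path.Homotopic.Quotient (vert S 1) (vert S a)) (hb : b = a * t)
    (h' : ∃ i, a⁻¹ * b ∈ S i) : step t ⟨a, p⟩ = ⟨b, p.trans (edge h')⟩ := by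
  subst hb
  exact dif_pos h

theorem step_one [Nonempty ι] (x : PathVertex S) : step 1 x = x := by
  obtain ⟨a, p⟩ := x
  have i := Classical.arbitrary ι
  have h : ∃ i, a⁻¹ * a ∈ S i := ⟨i, by simp [one_mem]⟩
  rw [step_eq (b := a) ⟨i, one_mem _⟩ p (by simp) h, edge_self,
    Path.Homotopic.Quotient.trans_refl]

theorem step_step [Nonempty ι] {i : ι} {t t' : G} (ht : t ∈ S i) (ht' : t' ∈ S i)
    (x : PathVertex S) : step t' (step t x) = step (t * t') x := by
  obtain ⟨a, p⟩ := x
  have h₁ : a⁻¹ * (a * t) ∈ S i := by simpa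
  have h₂ : (a * t)⁻¹ * (a * (t * t')) ∈ S i := by simpa [mul_assoc]
  have h₃ : ∃ i, a⁻¹ * (a * (t * t')) ∈ S i := ⟨i, by simpa using mul_mem ht ht'⟩
  rw [step_eq ⟨i, ht⟩ p rfl ⟨i, h₁⟩, step_eq ⟨i, ht'⟩ _ (mul_assoc a t t').symm ⟨i, h₂⟩,
    step_eq ⟨i, mul_mem ht ht'⟩ p rfl h₃, Path.Homotopic.Quotient.trans_assoc,
    edge_trans_edge h₁ h₂ h₃]

open scoped Classical in
/-- Prolongation by an edge is a permutation. -/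
def stepPerm [Nonempty ι] (t : G) : Equiv.Perm (PathVertex S) :=
  if h : ∃ i, t ∈ S i then
    -- Prolongation acts from the right; the inverse makes it a left action, hence multiplicative in
    -- `t`.
    { toFun := step t⁻¹
      invFun := step t
      left_inv := fun x => by
        obtain ⟨i, hi⟩ := h
        rw [step_step (inv_mem hi) hi, inv_mul_cancel, step_one]
      right_inv := fun x => by
        obtain ⟨i, hi⟩ := h
        rw [step_step hi (inv_mem hi), mul_inv_cancel, step_one] }
  else 1

theorem stepPerm_apply [Nonempty ι] {t : G} {i : ι} (h : t ∈ S i) (x : PathVertex S) :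
    stepPerm t x = step t⁻¹ x := by
  have : ∃ i, t ∈ S i := ⟨i, h⟩
  simp [stepPerm, this]

/-- The realization of `V_op(G, {Gᵢ})` is simply connected if `G` is the amalgam of the `Gᵢ`. -/
theorem simplyConnectedSpace [Nonempty ι]
    (hgen : ∀ H : Subgroup G, (∀ i, S i ≤ H) → H = ⊤)
    (hamalg : ∀ (Q : Type) [Group Q] (e : G → Q),
      (∀ i, ∀ a ∈ S i, ∀ b ∈ S i, e (a * b) = e a * e b) →
      ∃ φ : G →* Q, ∀ i, ∀ a ∈ S i, φ a = e a) :
    SimplyConnectedSpace (Realization (Vop G S)) := by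
  obtain ⟨φ, hφ⟩ := hamalg (Equiv.Perm (PathVertex S)) stepPerm fun i a ha b hb => by
    ext1 x
    rw [Equiv.Perm.mul_apply, stepPerm_apply (mul_mem ha hb), stepPerm_apply ha,
      stepPerm_apply hb, step_step (inv_mem hb) (inv_mem ha), mul_inv_rev]
  -- On end points the action of `g` is right multiplication by `g⁻¹`: this holds on each `S i`, and
  -- these generate `G`.
  have hfst : ∀ g (x : PathVertex S), (φ g x).1 = x.1 * g⁻¹ := by
    let H : Subgroup G :=
      { carrier := {g | ∀ x : PathVertex S, (φ g x).1 = x.1 * g⁻¹}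
        mul_mem' := fun {a b} ha hb x => by
          rw [map_mul, Equiv.Perm.mul_apply, ha, hb, mul_inv_rev, mul_assoc]
        one_mem' := fun x => by simp
        inv_mem' := fun {a} ha x => by
          have := ha (φ a⁻¹ x)
          rw [← Equiv.Perm.mul_apply, ← map_mul, mul_inv_cancel, map_one, Equiv.Perm.one_apply] at this
          rw [this]
          group }
    have hH : H = ⊤ := hgen H fun i t ht x => by
      rw [hφ i t ht, stepPerm_apply ht]
      have : ∃ i, t⁻¹ ∈ S i := ⟨i, inv_mem ht⟩
      rw [step, dif_pos this]
    intro g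
    exact (hH ▸ Subgroup.mem_top g : g ∈ H)
  -- Applying `g⁻¹` to the constant path at `1` gives a distinguished class `c g` of paths from `1`
  -- to `g`.
  have hc : ∀ g, ∃ c, φ g⁻¹ ⟨1, .refl _⟩ = (⟨g, c⟩ : PathVertex S) := by
    intro g
    have h := hfst g⁻¹ ⟨1, .refl _⟩
    rw [inv_inv, one_mul] at h
    generalize φ g⁻¹ ⟨1, .refl _⟩ = y at h
    obtain ⟨b, c⟩ := y
    obtain rfl : b = g := h
    exact ⟨c, rfl⟩
  choose c hc using hc
  -- As the action is by a group homomorphism, `b⁻¹ = (a⁻¹ b)⁻¹ a⁻¹` gives compatibility of the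
  -- classes `c` with every edge.
  have hedge : ∀ a b (h : ∃ i, a⁻¹ * b ∈ S i), (c a).trans (edge h) = c b := by
    intro a b h
    obtain ⟨i, hi⟩ := id h
    have h1 : φ b⁻¹ ⟨1, .refl _⟩ = step (a⁻¹ * b) (φ a⁻¹ ⟨1, .refl _⟩) := by
      rw [← inv_inv (a⁻¹ * b), ← stepPerm_apply (inv_mem hi), ← hφ i _ (inv_mem hi),
        ← Equiv.Perm.mul_apply, ← map_mul]
      congr 2
      group
    rw [hc, hc, step_eq ⟨i, hi⟩ (c a) (by group) h] at h1
    exact (eq_of_heq (Sigma.mk.inj h1).2).symm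
  have hne : ∀ q : Realization (Vop G S), ∃ v, q ∈ star (Vop G S) v := fun q =>
    (q.support_mem).1
  choose v hv using hne
  have hcont : ∀ {w : G} {q : Realization (Vop G S)}, q ∈ star (Vop G S) w →
      Contiguous (vert S w) q := fun hq => contiguous_vertex _ hq
  -- To reach a point, go to a vertex of its carrier and then along a segment; by `hedge` and the
  -- triangle in that simplex the choice of vertex is immaterial.
  have hindep : ∀ (w : G) (q : Realization (Vop G S)) (hq : q ∈ star (Vop G S) w),
      (c (v q)).trans (.mk (line (hcont (hv q)))) = (c w).trans (.mk (line (hcont hq))) := by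
    intro w q hq
    obtain ⟨-, i, hi⟩ := q.support_mem
    have h := hi w hq (v q) (hv q)
    rw [← hedge w (v q) ⟨i, h⟩, Path.Homotopic.Quotient.trans_assoc]
    congr 1
    refine line_trans_line q.support_mem ?_ ?_ subset_rfl _ _ _
    · rw [support_vert]
      exact Finset.singleton_subset_iff.2 hq
    · rw [support_vert]
      exact Finset.singleton_subset_iff.2 (hv q)
  refine simplyConnectedSpace_of_compatible
    (fun q => (c (v q)).trans (.mk (line (hcont (hv q))))) (star (Vop G S)) isOpen_star
    iUnion_star fun w p q δ hδ => ?_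
  have hp : p ∈ star (Vop G S) w := by simpa using hδ 0
  have hq : q ∈ star (Vop G S) w := by simpa using hδ 1
  rw [hindep w p hp, hindep w q hq, Path.Homotopic.Quotient.trans_assoc]
  congr 1
  exact line_trans_of_mem_star _ δ hδ _ _

/-! ### Translations that move points within a simplex -/

theorem mem_support_smul {g : G} {p : Realization (Vop G S)} {v : G} :
    v ∈ (g • p).weight.support ↔ g⁻¹ * v ∈ p.weight.support := by
  simp only [Finsupp.mem_support_iff, smul_weight]

/-- A vertex `u a` of `u • p` equals `a (a⁻¹ u a)`, so it differs from the vertex `a` of `p` by a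
right factor in `S i`. All vertices of both carriers thus lie in one coset of `S i`. -/
theorem contiguous_smul {u : G} {p : Realization (Vop G S)} {i : ι}
    (h₁ : ∀ a ∈ p.weight.support, ∀ b ∈ p.weight.support, a⁻¹ * b ∈ S i)
    (h₂ : ∀ a ∈ p.weight.support, a⁻¹ * u * a ∈ S i) : Contiguous (u • p) p := by
  classical
  have h : ∀ c ∈ (u • p).weight.support ∪ p.weight.support,
      ∃ a ∈ p.weight.support, a⁻¹ * c ∈ S i := by
    intro c hc
    rcases Finset.mem_union.1 hc with hc | hc
    · refine ⟨u⁻¹ * c, mem_support_smul.1 hc, ?_⟩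
      convert h₂ _ (mem_support_smul.1 hc) using 1
      group
    · exact ⟨c, hc, by simp [one_mem]⟩
  refine ⟨_, ⟨?_, i, fun c hc c' hc' => ?_⟩, Finset.subset_union_left, Finset.subset_union_right⟩
  · exact p.support_mem.1.mono Finset.subset_union_right
  · obtain ⟨a, ha, hac⟩ := h c hc
    obtain ⟨a', ha', hac'⟩ := h c' hc'
    convert mul_mem (mul_mem (inv_mem hac) (h₁ a ha a' ha')) hac' using 1
    group

theorem translation_one : translation (1 : G) = .id (Realization (Vop G S)) :=
  ContinuousMap.ext fun p => one_smul G p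

theorem translation_mul (g h : G) :
    translation (g * h) = (translation g).comp (translation (S := S) h) :=
  ContinuousMap.ext fun p => mul_smul g h p

/-- The elements whose left translation does not change the homotopy class of a map `f`. -/
def homotopyStabilizer {Z : Type*} [TopologicalSpace Z] (f : C(Z, Realization (Vop G S))) :
    Subgroup G where
  carrier := {g | ((translation g).comp f).Homotopic f}
  one_mem' := by
    change ((translation 1).comp f).Homotopic f
    rw [translation_one]
    exact .refl _
  mul_mem' := by
    intro g h hg hh
    change ((translation (g * h)).comp f).Homotopic f
    rw [translation_mul, ContinuousMap.comp_assoc]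
    exact ((ContinuousMap.Homotopic.refl (translation g)).comp hh).trans hg
  inv_mem' := by
    intro g hg
    change ((translation g⁻¹).comp f).Homotopic f
    have h : (translation g⁻¹).comp ((translation g).comp f) = f := by
      rw [← ContinuousMap.comp_assoc, ← translation_mul, inv_mul_cancel, translation_one]
      rfl
    have := (ContinuousMap.Homotopic.refl (translation (S := S) g⁻¹)).comp hg
    rw [h] at this
    exact this.symm

end Vop

/-! ## Translations are homotopic to the identity on compact spaces -/

namespace StNGroup

open Realization Vop

theorem simplyConnectedSpace : SimplyConnectedSpace XAlg := by
  have : Nonempty (Σ n : ℕ, PartialOrder (Fin n)) := ⟨⟨0, inferInstance⟩⟩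
  refine Vop.simplyConnectedSpace (fun H hH => stN_eq_top 0 fun n _ x y hxy => ?_)
    fun Q _ e he => exists_hom_of_mul_on_stableTriangular e he
  obtain ⟨s, hs⟩ := exists_order hxy
  exact hH ⟨n, s⟩ (mem_stableTriangular (el_mem_triangular hs))

/-- A finite set of vertices, and all its simplices, live at a finite stage. -/
theorem exists_stage (F : Finset StN) : ∃ N, (∀ a ∈ F, a ∈ (toStN N).range) ∧
    ∀ s ⊆ F, s ∈ (Vop StN stableTriangular).faces →
      ∃ m ≤ N, ∃ r : PartialOrder (Fin m), ∀ a ∈ s, ∀ b ∈ s,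
        a⁻¹ * b ∈ stableTriangular ⟨m, r⟩ := by
  choose n hn using exists_mem_range_toStN
  have hf : ∀ s : Finset StN, ∃ m, s ∈ (Vop StN stableTriangular).faces →
      ∃ r : PartialOrder (Fin m), ∀ a ∈ s, ∀ b ∈ s, a⁻¹ * b ∈ stableTriangular ⟨m, r⟩ := by
    intro s
    by_cases hs : s ∈ (Vop StN stableTriangular).faces
    · obtain ⟨-, ⟨m, r⟩, h⟩ := id hs
      exact ⟨m, fun _ => ⟨r, h⟩⟩
    · exact ⟨0, fun h => absurd h hs⟩
  choose m hm using hf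
  refine ⟨max (F.sup n) (F.powerset.sup m), fun a ha => ?_, fun s hsF hs => ?_⟩
  · exact range_toStN_mono ((Finset.le_sup ha).trans (le_max_left _ _)) (hn a)
  · exact ⟨m s, (Finset.le_sup (Finset.mem_powerset.2 hsF)).trans (le_max_right _ _), hm s hs⟩

/-- Compactness leaves an index free of all simplices that `f` meets, and the letters with that
index supply the small moves whose commutators are the generators. -/
theorem translation_comp_homotopic {Z : Type*} [TopologicalSpace Z] [CompactSpace Z]
    (f : C(Z, XAlg)) (g : StN) : ((translation g).comp f).Homotopic f := by
  obtain ⟨F, hF⟩ := exists_finset_of_isCompact (isCompact_range f.continuous)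
  obtain ⟨N₀, hrange, hface⟩ := exists_stage F
  have key : ∀ N, N₀ ≤ N → ∀ u, (u ∈ stableLower N ∨ u ∈ stableUpper N) →
      u ∈ homotopyStabilizer f := by
    intro N hN u hu
    refine ⟨(straightHomotopy _ _ fun z => ?_).toHomotopy⟩
    have hz := hF (f z) ⟨z, rfl⟩
    obtain ⟨m, hm, r, hr⟩ := hface _ hz (f z).support_mem
    have ha : ∀ a ∈ (f z).weight.support, a ∈ (toStN N).range := fun a ha =>
      range_toStN_mono hN (hrange a (hz ha))
    rcases hu with hu | hu
    · obtain ⟨p, hp₁, hp₂⟩ := exists_stableTriangular_lower (hm.trans hN) r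
      exact contiguous_smul (fun a ha b hb => hp₁ (hr a ha b hb))
        fun a h => hp₂ (conj_mem_stableLower (ha a h) hu)
    · obtain ⟨p, hp₁, hp₂⟩ := exists_stableTriangular_upper (hm.trans hN) r
      exact contiguous_smul (fun a ha b hb => hp₁ (hr a ha b hb))
        fun a h => hp₂ (conj_mem_stableUpper (ha a h) hu)
  -- The choice of a new index works at every stage from `N₀` on, so generators of all late stages
  -- are reached.
  have htop : homotopyStabilizer f = ⊤ := stN_eq_top N₀ fun N hN x y hxy => by
    obtain ⟨u, hu, v, hv, h⟩ := exists_commutator hxy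
    have hu := key N hN u (Or.inl hu)
    have hv := key N hN v (Or.inr hv)
    rw [h]
    exact mul_mem (mul_mem (mul_mem hu hv) (inv_mem hu)) (inv_mem hv)
  exact (htop ▸ Subgroup.mem_top g : g ∈ homotopyStabilizer f)

end StNGroup

/-! ## Singular homology has compact supports -/

namespace SingularChains

open AlgebraicTopology Limits Simplicial

section Elements

variable {R : Type} [CommRing R] {M N : ModuleCat.{0} R}

/-- An element of a module, as a morphism. -/
def elementHom (m : M) : ModuleCat.of R R ⟶ M :=
  ModuleCat.ofHom (LinearMap.toSpanSingleton R M m)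

theorem elementHom_comp (m : M) (f : M ⟶ N) : elementHom m ≫ f = elementHom (f.hom m) := by
  ext
  simp [elementHom]

theorem elementHom_injective : Function.Injective (elementHom (M := M)) := fun m m' h => by
  simpa [elementHom] using congrArg (fun φ => φ.hom (1 : R)) h

/-- Test with the quotient map of `P`. This lets a submodule of chains be compared with the whole
through morphisms, which are determined on simplices. -/
theorem eq_top_of_forall_hom (P : Submodule R M)
    (h : ∀ (T : ModuleCat.{0} R) (φ : M ⟶ T), (∀ m ∈ P, φ.hom m = 0) → φ = 0) : P = ⊤ := by
  have := h (ModuleCat.of R (M ⧸ P)) (ModuleCat.ofHom P.mkQ) fun m hm =>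
    (Submodule.Quotient.mk_eq_zero P).2 hm
  rw [← Submodule.ker_mkQ P, LinearMap.ker_eq_top]
  exact congrArg ModuleCat.Hom.hom this

end Elements

/-- The singular chain complex with integer coefficients. -/
abbrev chains : TopCat.{0} ⥤ ChainComplex (ModuleCat.{0} ℤ) ℕ :=
  (singularChainComplexFunctor (ModuleCat.{0} ℤ)).obj (ModuleCat.of ℤ ℤ)

/-- The inclusion of a subspace. -/
def incl {X : TopCat.{0}} (A : Set X) : TopCat.of A ⟶ X :=
  TopCat.ofHom ⟨Subtype.val, continuous_subtype_val⟩

/-- The inclusion of a subspace in a larger one. -/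
def inclOfLE {X : TopCat.{0}} {A B : Set X} (h : A ⊆ B) : TopCat.of A ⟶ TopCat.of B :=
  TopCat.ofHom ⟨Set.inclusion h, continuous_inclusion h⟩

theorem inclOfLE_comp_incl {X : TopCat.{0}} {A B : Set X} (h : A ⊆ B) :
    inclOfLE h ≫ incl B = incl A := rfl

instance {X : TopCat.{0}} (A : Set X) : Mono (incl A) :=
  (TopCat.mono_iff_injective _).2 Subtype.val_injective

theorem range_mono {X : TopCat.{0}} {A B : Set X} (h : A ⊆ B) (k : ℕ) :
    LinearMap.range ((chains.map (incl A)).f k).hom ≤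
      LinearMap.range ((chains.map (incl B)).f k).hom := by
  rintro _ ⟨w, rfl⟩
  refine ⟨((chains.map (inclOfLE h)).f k).hom w, ?_⟩
  rw [← inclOfLE_comp_incl h, Functor.map_comp]
  rfl

/-- The chains with compact support. -/
def compactChains (X : TopCat.{0}) (k : ℕ) : Submodule ℤ ((chains.obj X).X k) where
  carrier := {w | ∃ A : Set X, IsCompact A ∧ w ∈ LinearMap.range ((chains.map (incl A)).f k).hom}
  zero_mem' := ⟨∅, isCompact_empty, zero_mem _⟩
  add_mem' := by
    rintro _ _ ⟨A, hA, ha⟩ ⟨B, hB, hb⟩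
    exact ⟨A ∪ B, hA.union hB, add_mem (range_mono Set.subset_union_left k ha)
      (range_mono Set.subset_union_right k hb)⟩
  smul_mem' := by
    rintro c _ ⟨A, hA, ha⟩
    exact ⟨A, hA, Submodule.smul_mem _ c ha⟩

/-- A singular simplex factors through its image, which is compact. -/
theorem exists_lift_simplex {X : TopCat.{0}} {k : ℕ} (x : (TopCat.toSSet.obj X) _⦋k⦌) :
    ∃ A : Set X, IsCompact A ∧
      ∃ y : (TopCat.toSSet.obj (TopCat.of A)) _⦋k⦌, (TopCat.toSSet.map (incl A)).app _ y = x := by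
  let s := X.toSSetObjEquiv _ x
  refine ⟨Set.range s, isCompact_range s.continuous,
    ((TopCat.of (Set.range s)).toSSetObjEquiv _).symm
      ⟨Set.rangeFactorization s, s.continuous.rangeFactorization⟩, ?_⟩
  exact (X.toSSetObjEquiv _).injective rfl

theorem compactChains_eq_top (X : TopCat.{0}) (k : ℕ) : compactChains X k = ⊤ := by
  refine eq_top_of_forall_hom _ fun T φ hφ => ?_
  refine SSet.chainComplex_hom_ext (X := TopCat.toSSet.obj X) (R := ModuleCat.of ℤ ℤ) fun x => ?_
  obtain ⟨A, hA, y, rfl⟩ := exists_lift_simplex x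
  rw [← SSet.ι_chainComplexMap_f]
  ext
  exact hφ _ ⟨A, hA, _, rfl⟩

/-- A self-map which is homotopic to the identity on every compact set acts trivially on
singular homology. -/
theorem homology_map_eq_id {X : TopCat.{0}} (f : X ⟶ X)
    (hf : ∀ A : Set X, IsCompact A → (incl A ≫ f).hom.Homotopic (incl A).hom) (k : ℕ) :
    (integralHomology k).map f = 𝟙 ((integralHomology k).obj X) := by
  change HomologicalComplex.homologyMap (chains.map f) k = 𝟙 _
  rw [← cancel_epi ((chains.obj X).homologyπ k), Category.comp_id]
  ext z
  obtain ⟨A, hA, w, hw⟩ : ((chains.obj X).iCycles k).hom z ∈ compactChains X k := by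
    rw [compactChains_eq_top]
    trivial
  obtain ⟨H⟩ := hf A hA
  let ζ : ModuleCat.of ℤ ℤ ⟶ (chains.obj X).cycles k := elementHom z
  let ω : ModuleCat.of ℤ ℤ ⟶ (chains.obj (TopCat.of A)).X k := elementHom w
  have hωζ : ω ≫ (chains.map (incl A)).f k = ζ ≫ (chains.obj X).iCycles k := by
    rw [elementHom_comp, elementHom_comp, hw]
  have hmono : ∀ j, Mono ((chains.map (incl A)).f j) := fun j => inferInstance
  -- The chain `w` is a cycle already in `A`, because the inclusion is injective on chains and the
  -- image of `w` is the cycle `z`.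
  have hω : ω ≫ (chains.obj (TopCat.of A)).d k ((ComplexShape.down ℕ).next k) = 0 := by
    rw [← cancel_mono ((chains.map (incl A)).f _), Category.assoc, ← HomologicalComplex.Hom.comm,
      reassoc_of% hωζ, HomologicalComplex.iCycles_d, Limits.comp_zero, Limits.zero_comp]
  have hζ : ζ = (chains.obj (TopCat.of A)).liftCycles ω _ rfl hω ≫
      HomologicalComplex.cyclesMap (chains.map (incl A)) k := by
    rw [← cancel_mono ((chains.obj X).iCycles k), Category.assoc,
      HomologicalComplex.cyclesMap_i, HomologicalComplex.liftCycles_i_assoc, hωζ]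
  -- The class of `z` comes from `A`, and on `A` the map `f` is homotopic to the inclusion.
  have key : ζ ≫ (chains.obj X).homologyπ k ≫ HomologicalComplex.homologyMap (chains.map f) k =
      ζ ≫ (chains.obj X).homologyπ k := by
    have hH := TopCat.Homotopy.congr_homologyMap_singularChainComplexFunctor
      (f := incl A ≫ f) (g := incl A) H (ModuleCat.of ℤ ℤ) k
    rw [Functor.map_comp, HomologicalComplex.homologyMap_comp] at hH
    rw [hζ]
    simp only [Category.assoc, ← HomologicalComplex.homologyπ_naturality_assoc,
      ← HomologicalComplex.homologyπ_naturality]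
    rw [hH]
  rw [elementHom_comp, elementHom_comp] at key
  exact elementHom_injective key

end SingularChains

/-! ## Change of base point -/

namespace HomotopyGroup

variable {X : Type} [TopologicalSpace X] {k : ℕ} {x y : X}

theorem extend_eq_projIcc (γ : Path x y) (t : ℝ) :
    γ.extend t = γ (Set.projIcc 0 1 zero_le_one t) := rfl

/-- The inner cube stays fixed and the homotopy of paths is run on the radial segments of the shell.
-/
theorem transportLoop_homotopic_of_path {γ γ' : Path x y} (h : γ.Homotopic γ')
    (p : Ω^ (Fin k) X x) : GenLoop.Homotopic (transportLoop γ p) (transportLoop γ' p) := by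
  obtain ⟨H⟩ := h
  refine ⟨⟨⟨⟨fun u => if cubeRadius u.2 ≤ 1 / 2 then p (cubeExpand u.2)
    else H (u.1, Set.projIcc 0 1 zero_le_one (2 * cubeRadius u.2 - 1)), ?_⟩, ?_, ?_⟩, ?_⟩⟩
  · refine Continuous.if_le ?_ ?_ (continuous_cubeRadius.comp continuous_snd) continuous_const ?_
    · exact p.1.continuous.comp (continuous_cubeExpand.comp continuous_snd)
    · exact H.continuous.comp (continuous_fst.prodMk (continuous_projIcc.comp
        ((continuous_const.mul (continuous_cubeRadius.comp continuous_snd)).sub continuous_const)))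
    · rintro ⟨s, t⟩ ht
      dsimp only at ht ⊢
      rw [show p (cubeExpand t) = x from p.2 _ (cubeExpand_mem_boundary ht), ht]
      norm_num
  · intro t
    simp [transportLoop, extend_eq_projIcc]
  · intro t
    simp [transportLoop, extend_eq_projIcc]
  · intro s t ht
    have h := cubeRadius_of_mem_boundary ht
    simp only [ContinuousMap.coe_mk, transportLoop, h]
    norm_num

theorem transport_eq_of_homotopic {γ γ' : Path x y} (h : γ.Homotopic γ') (a : π_ k X x) :
    transport γ a = transport γ' a := by
  induction a using Quotient.inductionOn with
  | h p => exact Quotient.sound (transportLoop_homotopic_of_path h p)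

/-- The expansion of the concentric subcube of size `(1 + s) / 2` to `I^k`. -/
def cubeExpandBy (u : I × (I^ (Fin k))) : I^ (Fin k) :=
  fun i => Set.projIcc 0 1 zero_le_one ((2 * (u.2 i : ℝ) - 1) / (1 + u.1) + 1 / 2)

theorem one_add_pos (s : I) : (0 : ℝ) < 1 + s := by
  linarith [s.2.1]

theorem continuous_cubeExpandBy : Continuous (cubeExpandBy (k := k)) := by
  refine continuous_pi fun i => continuous_projIcc.comp ?_
  refine (Continuous.div ?_ ?_ fun u : I × (I^ (Fin k)) => (one_add_pos u.1).ne').add continuous_const <;> fun_prop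

theorem cubeExpandBy_zero (t : I^ (Fin k)) : cubeExpandBy (0, t) = cubeExpand t := by
  funext i
  simp only [cubeExpandBy, cubeExpand]
  congr 1
  norm_num
  ring

theorem cubeExpandBy_one (t : I^ (Fin k)) : cubeExpandBy (1, t) = t := by
  funext i
  have h : (2 * (t i : ℝ) - 1) / (1 + (1 : I)) + 1 / 2 = t i := by
    norm_num
    ring
  simp only [cubeExpandBy]
  rw [h]
  exact Set.projIcc_val zero_le_one (t i)

theorem cubeExpandBy_mem_boundary {s : I} {t : I^ (Fin k)} (ht : cubeRadius t = (1 + s) / 2) :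
    cubeExpandBy (s, t) ∈ Cube.boundary (Fin k) := by
  have hs := one_add_pos s
  by_contra hcon
  have hlt : ∀ i, ‖2 * (t i : ℝ) - 1‖ < (1 + s) / 2 := by
    intro i
    rw [Real.norm_eq_abs, abs_lt]
    constructor
    · by_contra! h
      refine hcon ⟨i, Or.inl (Set.projIcc_of_le_left _ ?_)⟩
      have : (2 * (t i : ℝ) - 1) / (1 + s) ≤ -(1 / 2) := by
        rw [div_le_iff₀ hs]
        linarith
      linarith
    · by_contra! h
      refine hcon ⟨i, Or.inr (Set.projIcc_of_right_le _ ?_)⟩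
      have : 1 / 2 ≤ (2 * (t i : ℝ) - 1) / (1 + s) := by
        rw [le_div_iff₀ hs]
        linarith
      linarith
  have := (pi_norm_lt_iff (by linarith : (0 : ℝ) < (1 + s) / 2)).2 hlt
  exact absurd ht (ne_of_lt this)

theorem cubeRadius_le_one (t : I^ (Fin k)) : cubeRadius t ≤ 1 := by
  refine (pi_norm_le_iff_of_nonneg zero_le_one).2 fun i => ?_
  rw [Real.norm_eq_abs, abs_le]
  constructor <;> linarith [(t i).2.1, (t i).2.2]

/-- A free homotopy of generalized loops which moves the boundary along `γ` identifies the end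
with the transport of the start along `γ`. -/
theorem transportLoop_homotopic_of_free (γ : Path x y) (p : Ω^ (Fin k) X x) (q : Ω^ (Fin k) X y)
    (H : p.1.Homotopy q.1) (hH : ∀ s, ∀ t ∈ Cube.boundary (Fin k), H (s, t) = γ s) :
    GenLoop.Homotopic (transportLoop γ p) q := by
  -- At time `s` the inner cube of radius `(1 + s) / 2` carries the stage `s` of `H`, and the shell
  -- carries the part of `γ` from `s` to `1`. At `s = 0` this is the transport, and at `s = 1` the
  -- shell is gone.
  refine ⟨⟨⟨⟨fun u => if cubeRadius u.2 ≤ (1 + u.1) / 2 then H (u.1, cubeExpandBy u)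
    else γ.extend (2 * cubeRadius u.2 - 1), ?_⟩, ?_, ?_⟩, ?_⟩⟩
  · refine Continuous.if_le ?_ ?_ (continuous_cubeRadius.comp continuous_snd) (by fun_prop) ?_
    · exact H.continuous.comp (continuous_fst.prodMk continuous_cubeExpandBy)
    · exact γ.continuous_extend.comp ((continuous_const.mul
        (continuous_cubeRadius.comp continuous_snd)).sub continuous_const)
    · rintro ⟨s, t⟩ ht
      dsimp only at ht ⊢
      have h : 2 * ((1 + (s : ℝ)) / 2) - 1 = s := by ring
      rw [hH s _ (cubeExpandBy_mem_boundary ht), ht, h, extend_eq_projIcc,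
        Set.projIcc_val zero_le_one s]
  · intro t
    have h : H (0, cubeExpand t) = p (cubeExpand t) := H.apply_zero _
    simp [transportLoop, cubeExpandBy_zero, h]
  · intro t
    have h : H (1, t) = q.1 t := H.apply_one _
    have h1 : (1 + ((1 : I) : ℝ)) / 2 = 1 := by norm_num
    simp only [h1, cubeRadius_le_one, if_true, cubeExpandBy_one, h]
  · intro s t ht
    have h1 := cubeRadius_of_mem_boundary ht
    have h2 : transportLoop γ p t = y := (transportLoop γ p).2 t ht
    refine Eq.trans ?_ h2.symm
    change (if cubeRadius t ≤ (1 + (s : ℝ)) / 2 then H (s, cubeExpandBy (s, t))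
      else γ.extend (2 * cubeRadius t - 1)) = y
    split_ifs with hle
    -- On the boundary the radius is `1`, so the inner case occurs only at time `1`.
    · have hs : s = 1 := Subtype.ext (le_antisymm s.2.2 (by
        rw [h1] at hle
        change (1 : ℝ) ≤ s
        linarith))
      rw [hs, cubeExpandBy_one, hH 1 t ht, γ.target]
    · rw [h1]
      norm_num

end HomotopyGroup

/-! ## The action on the homology and homotopy groups -/

namespace StNGroup

open Vop

/-- The homotopy from the inclusion of a compact set to its translate gives a free homotopy from the
loop to its image, whose boundary runs along the track `η` of the base point; simple connectivity
replaces `η` by `γ`. -/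
theorem induced_translation_eq_transport (k : ℕ) (g : StN) (x : XAlg)
    (γ : Path x (translation g x)) (a : π_ k XAlg x) :
    HomotopyGroup.induced k (translation g) x a = HomotopyGroup.transport γ a := by
  induction a using Quotient.inductionOn with
  | h p =>
    -- The base point is added because for `k = 0` the cube has no boundary and `x` need not be in
    -- the range.
    have hcomp : IsCompact (Set.range p.1 ∪ {x}) :=
      (isCompact_range p.1.continuous).union isCompact_singleton
    have := isCompact_iff_compactSpace.1 hcomp
    let j : C((Set.range p.1 ∪ {x} : Set XAlg), XAlg) := ⟨Subtype.val, continuous_subtype_val⟩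
    obtain ⟨H⟩ := (translation_comp_homotopic j g).symm
    let η : Path x (translation g x) := H.evalAt ⟨x, Or.inr rfl⟩
    have := simplyConnectedSpace
    refine Eq.trans ?_ (HomotopyGroup.transport_eq_of_homotopic
      (SimplyConnectedSpace.paths_homotopic γ η) _).symm
    let f : C(I^ (Fin k), (Set.range p.1 ∪ {x} : Set XAlg)) :=
      ⟨fun t => ⟨p.1 t, Or.inl ⟨t, rfl⟩⟩, p.1.continuous.subtype_mk _⟩
    let q : Ω^ (Fin k) XAlg (translation g x) :=
      ⟨(translation g).comp p.1, fun t ht => congrArg (translation g) (p.2 t ht)⟩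
    refine (Quotient.sound (HomotopyGroup.transportLoop_homotopic_of_free η p q
      (H.comp (ContinuousMap.Homotopy.refl f)) fun s t ht => ?_)).symm
    change H (s, ⟨p.1 t, _⟩) = H (s, ⟨x, _⟩)
    congr 3
    exact p.2 t ht

theorem homology_translation (k : ℕ) (g : StN) :
    (integralHomology k).map (TopCat.ofHom (translation g : C(XAlg, XAlg))) =
      𝟙 ((integralHomology k).obj (TopCat.of XAlg)) := by
  refine SingularChains.homology_map_eq_id _ (fun A hA => ?_) k
  have := isCompact_iff_compactSpace.1 hA
  exact translation_comp_homotopic (SingularChains.incl A).hom g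

end StNGroup

end

theorem mainTheorem9 :
    (∀ (k : ℕ) (g : StNGroup.StN),
      (integralHomology k).map (TopCat.ofHom (Vop.translation g : C(XAlg, XAlg))) =
        𝟙 ((integralHomology k).obj (TopCat.of XAlg))) ∧
    PathConnectedSpace XAlg ∧
    (∀ (k : ℕ) (g : StNGroup.StN) (x : XAlg) (γ : Path x (Vop.translation g x))
      (a : π_ k XAlg x),
      HomotopyGroup.induced k (Vop.translation g) x a = HomotopyGroup.transport γ a) := by
  have := StNGroup.simplyConnectedSpace
  exact ⟨StNGroup.homology_translation, inferInstance, StNGroup.induced_translation_eq_transport⟩
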